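/- Let $G=\widetilde{\mathrm{Isom}(\mathbb{R}^2)}$ be the universal covering group of the (identity component of the) isometry group of the Euclidean plane, i.e. $\mathbb{R}^3$ with coordinates $(x,y,\theta)$, where $(w,\theta)(w',\theta')=(w+\mathrm{Rot}_\theta w',\,\theta+\theta')$ for $w=(x,y)$. For a Riemannian metric $g$ on $G$ with Ricci tensor $R_{ij}$ and scalar curvature $R$, let $$C_{ij}=g_{ik}\,\varepsilon^{klm}\Big(\nabla_lR_{mj}-\tfrac14\nabla_lR\,g_{mj}\Big)$$ be the Cotton–York tensor, where $\varepsilon^{klm}=\eta^{klm}/\sqrt{\det g}$ and $\eta^{klm}$ is the completely antisymmetric symbol with $\eta^{123}=1$; put $|C_2|_g^2=g^{ip}g^{jq}C_{ij}C_{pq}$, and for compact $K\subset G$ let $C_K(g)=\int_K|C_2|_g\,d\mu_g$, where $d\mu_g$ is the volume element of $g$. Let $g_0$ be any left-invariant Riemannian metric on $G$. Then $g_0$ has a Milnor frame, i.e. a frame of left-invariant vector fields $F_1,F_2,F_3$ with $[F_2,F_3]=-2F_1$, $[F_3,F_1]=-2F_2$, $[F_1,F_2]=0$ and $$g_0=A_0\,\omega^1\otimes\omega^1+B_0\,\omega^2\otimes\omega^2+C_0\,\omega^3\otimes\omega^3,\qquad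 A_0,B_0,C_0>0,$$ where $\omega^1,\omega^2,\omega^3$ is the dual coframe. There is a solution $g(t)$, $0\le t<\infty$, of the Ricci flow $\frac{\partial}{\partial t}g=-2\,\mathrm{Ric}_{g}$ with $g(0)=g_0$ that consists of left-invariant metrics, and any solution on an interval $[0,T)$ that starts at $g_0$ and consists of left-invariant metrics agrees with it on $[0,T)$. For every Milnor frame of $g_0$ as above and every compact set $K\subset G$: 1. If $A_0\neq B_0$, then $C_K(g(t))\to0$ as $t\to\infty$, and if moreover $K$ has positive volume, then $t\mapsto C_K(g(t))$ is strictly decreasing on $[0,\infty)$. 2. If $A_0=B_0$, then $C_K(g(t))=0$ for all $t\ge0$. -/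

import Mathlib

open Set Filter Topology MeasureTheory
open scoped ContDiff

noncomputable section

namespace CottonFlow

/-! ### The universal cover of the isometry group of the plane

As a manifold it is `ℝ³`, with global coordinates `p = (x, y, θ)`. The point `(x, y, θ)` lies over
the rigid motion `z ↦ exp (i θ) z + (x + i y)` of the plane. -/

/-- The underlying manifold `ℝ³`, in global coordinates `(x, y, θ)`. -/
abbrev Pt : Type := Fin 3 → ℝ

/-- The product of the universal cover of `Isom(ℝ²)`:
`(w, θ) (w', θ') = (w + rotation by θ of w', θ + θ')`. -/
def mul (a p : Pt) : Pt :=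
  ![a 0 + (Real.cos (a 2) * p 0 - Real.sin (a 2) * p 1),
    a 1 + (Real.sin (a 2) * p 0 + Real.cos (a 2) * p 1),
    a 2 + p 2]

/-- The inverse of `(w, θ)`. -/
def inv (a : Pt) : Pt :=
  ![-(Real.cos (a 2) * a 0 + Real.sin (a 2) * a 1),
    Real.sin (a 2) * a 0 - Real.cos (a 2) * a 1,
    -a 2]

/-- The group structure on `ℝ³` (not the pointwise product of functions `Fin 3 → ℝ`). -/
@[reducible]
def groupStructure : Group Pt :=
  @Group.ofLeftAxioms Pt ⟨mul⟩ ⟨inv⟩ ⟨fun _ => 0⟩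
    (fun a b c => by
      change mul (mul a b) c = mul a (mul b c)
      funext i
      fin_cases i <;> simp [mul, Real.cos_add, Real.sin_add] <;> ring)
    (fun a => by
      change mul (fun _ => 0) a = a
      funext i
      fin_cases i <;> simp [mul])
    (fun a => by
      change mul (inv a) a = fun _ => 0
      funext i
      fin_cases i <;> simp [mul, inv])

/-- The rigid motion of the plane below a point of the cover. -/
def rigidMotion (a : Pt) (z : ℂ) : ℂ :=
  Complex.exp (a 2 * Complex.I) * z + (a 0 + a 1 * Complex.I)

theorem rigidMotion_isometry (a : Pt) : Isometry (rigidMotion a) := by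
  refine Isometry.of_dist_eq fun z w => ?_
  simp only [rigidMotion, dist_eq_norm, add_sub_add_right_eq_sub, ← mul_sub, norm_mul,
    Complex.norm_exp_ofReal_mul_I, one_mul]

theorem rigidMotion_mul (a b : Pt) : rigidMotion (mul a b) = rigidMotion a ∘ rigidMotion b := by
  funext z
  simp only [rigidMotion, mul, Function.comp, Matrix.cons_val]
  push_cast
  rw [add_mul, Complex.exp_add, Complex.exp_mul_I (a 2 : ℂ)]
  linear_combination (-(Complex.sin (a 2) * b 1)) * Complex.I_sq

/-- Every orientation preserving rigid motion is covered. -/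
theorem exists_rigidMotion (c w : ℂ) (hc : ‖c‖ = 1) : ∃ a, rigidMotion a = fun z => c * z + w := by
  refine ⟨![w.re, w.im, c.arg], ?_⟩
  funext z
  have h := Complex.norm_mul_exp_arg_mul_I c
  rw [hc, Complex.ofReal_one, one_mul] at h
  simp [rigidMotion, h, Complex.re_add_im]

/-- The fibres are the cosets of the discrete subgroup `{(0, 0, 2 π n)}`. -/
theorem rigidMotion_eq_iff (a b : Pt) : rigidMotion a = rigidMotion b ↔
    a 0 = b 0 ∧ a 1 = b 1 ∧ ∃ n : ℤ, a 2 = b 2 + n * (2 * Real.pi) := by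
  constructor
  · intro h
    have h0 := congrFun h 0
    have h1 := congrFun h 1
    simp only [rigidMotion, mul_zero, zero_add, mul_one] at h0 h1
    have hr := congrArg Complex.re h0
    have hi := congrArg Complex.im h0
    simp at hr hi
    rw [h0, add_left_inj, Complex.exp_eq_exp_iff_exists_int] at h1
    obtain ⟨n, hn⟩ := h1
    refine ⟨hr, hi, n, ?_⟩
    have := congrArg Complex.im hn
    simpa using this
  · rintro ⟨h0, h1, n, h2⟩
    funext z
    simp only [rigidMotion, h0, h1, h2]
    push_cast
    have : ((b 2 : ℂ) + n * (2 * Real.pi)) * Complex.I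
        = b 2 * Complex.I + n * (2 * Real.pi * Complex.I) := by ring
    rw [this, Complex.exp_add, Complex.exp_int_mul_two_pi_mul_I, mul_one]

/-! ### Riemannian geometry in the global coordinates

A metric is given by the matrix `g p i j = g_p(∂ᵢ, ∂ⱼ)`. -/

/-- A field of bilinear forms on `ℝ³`, by its components. -/
abbrev Form : Type := Pt → Matrix (Fin 3) (Fin 3) ℝ

/-- The value of a field of bilinear forms at the tangent vectors `u`, `v` at `p`. -/
def Form.app (T : Form) (p u v : Pt) : ℝ := ∑ i, ∑ j, T p i j * u i * v j

/-- Smooth Riemannian metrics. -/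
structure IsRiemannianMetric (g : Form) : Prop where
  smooth : ∀ i j, ContDiff ℝ ∞ fun p => g p i j
  posDef : ∀ p, (g p).PosDef

/-- The partial derivative `∂ᵢ f`. -/
def pd (i : Fin 3) (f : Pt → ℝ) (p : Pt) : ℝ := fderiv ℝ f p (Pi.single i 1)

/-- The Christoffel symbol `Γᵏᵢⱼ`. -/
def christoffel (g : Form) (k i j : Fin 3) (p : Pt) : ℝ :=
  (1 / 2) * ∑ l, (g p)⁻¹ k l *
    (pd i (fun q => g q j l) p + pd j (fun q => g q i l) p - pd l (fun q => g q i j) p)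

/-- The component of `∂ₗ` in `R(∂ᵢ, ∂ⱼ) ∂ₖ = ∇ᵢ ∇ⱼ ∂ₖ - ∇ⱼ ∇ᵢ ∂ₖ`. -/
def riemann (g : Form) (i j k l : Fin 3) (p : Pt) : ℝ :=
  pd i (christoffel g l j k) p - pd j (christoffel g l i k) p
    + ∑ m, (christoffel g l i m p * christoffel g m j k p
        - christoffel g l j m p * christoffel g m i k p)

/-- The Ricci tensor `Rⱼₖ`, the trace of `X ↦ R(X, ∂ⱼ) ∂ₖ`. -/
def ricci (g : Form) : Form := fun p j k => ∑ i, riemann g i j k i p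

/-- The scalar curvature. -/
def scalar (g : Form) (p : Pt) : ℝ := ∑ i, ∑ j, (g p)⁻¹ i j * ricci g p i j

/-- The covariant derivative `∇ₗ Tᵢⱼ` of a field of bilinear forms. -/
def covDeriv (g T : Form) (l i j : Fin 3) (p : Pt) : ℝ :=
  pd l (fun q => T q i j) p
    - ∑ n, (christoffel g n l i p * T p n j + christoffel g n l j p * T p i n)

/-- The completely antisymmetric symbol, with `eta 0 1 2 = 1`. -/
def eta (i j k : Fin 3) : ℝ :=
  (((i : ℕ) : ℝ) - ((j : ℕ) : ℝ)) * (((j : ℕ) : ℝ) - ((k : ℕ) : ℝ))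
    * (((k : ℕ) : ℝ) - ((i : ℕ) : ℝ)) / 2

/-- The Cotton-York tensor `Cᵢⱼ = gᵢₖ εᵏˡᵐ (∇ₗ Rₘⱼ - (1/4) ∇ₗ R gₘⱼ)`, `εᵏˡᵐ = ηᵏˡᵐ / √(det g)`. -/
def cottonYork (g : Form) : Form := fun p i j =>
  ∑ k, ∑ l, ∑ m, g p i k * (eta k l m / Real.sqrt (g p).det) *
    (covDeriv g (ricci g) l m j p - (1 / 4) * pd l (scalar g) p * g p m j)

/-- The pointwise norm `|T|_g`, with `|T|_g² = gⁱᵃ gʲᵇ Tᵢⱼ Tₐᵦ`. -/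
def tensorNorm (g T : Form) (p : Pt) : ℝ :=
  Real.sqrt (∑ i, ∑ j, ∑ a, ∑ b, (g p)⁻¹ i a * (g p)⁻¹ j b * T p i j * T p a b)

/-- The `L¹`-norm over `K` of the Cotton-York tensor, for the volume element
`√(det g) dx dy dθ` of `g`. -/
def cottonYorkL1 (K : Set Pt) (g : Form) : ℝ :=
  ∫ p in K, tensorNorm g (cottonYork g) p * Real.sqrt (g p).det

/-- `g t`, for `t` in the interval `I`, is a solution of the Ricci flow `∂g/∂t = -2 Ric`
(one-sided derivative at an endpoint that belongs to `I`). -/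
structure IsRicciFlowOn (I : Set ℝ) (g : ℝ → Form) : Prop where
  metric : ∀ t ∈ I, IsRiemannianMetric (g t)
  evolution : ∀ t ∈ I, ∀ p i j,
    HasDerivWithinAt (fun s => g s p i j) (-2 * ricci (g t) p i j) I t

/-! ### Left-invariant objects -/

/-- Left translations preserve the field of bilinear forms. -/
def IsLeftInvariant (g : Form) : Prop :=
  ∀ a p u v, g.app (mul a p) (fderiv ℝ (mul a) p u) (fderiv ℝ (mul a) p v) = g.app p u v

/-- Left translations preserve the vector field. -/
def IsLeftInvariantField (X : Pt → Pt) : Prop :=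
  ∀ a p, fderiv ℝ (mul a) p (X p) = X (mul a p)

/-- `F₁, F₂, F₃` (indexed by `0, 1, 2`) is a Milnor frame for `g`, with
`g = A ω¹ ⊗ ω¹ + B ω² ⊗ ω² + C ω³ ⊗ ω³` in the dual coframe: a left-invariant frame with
`[F₂, F₃] = -2 F₁`, `[F₃, F₁] = -2 F₂`, `[F₁, F₂] = 0`. -/
structure IsMilnorFrame (g : Form) (F : Fin 3 → Pt → Pt) (A B C : ℝ) : Prop where
  leftInvariant : ∀ i, IsLeftInvariantField (F i)
  bracket_23 : ∀ p, VectorField.lieBracket ℝ (F 1) (F 2) p = (-2 : ℝ) • F 0 p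
  bracket_31 : ∀ p, VectorField.lieBracket ℝ (F 2) (F 0) p = (-2 : ℝ) • F 1 p
  bracket_12 : ∀ p, VectorField.lieBracket ℝ (F 0) (F 1) p = 0
  linearIndependent : ∀ p, LinearIndependent ℝ fun i => F i p
  pos : 0 < A ∧ 0 < B ∧ 0 < C
  diagonal : ∀ p i j, g.app p (F i p) (F j p) = Matrix.diagonal ![A, B, C] i j

end CottonFlow

end

/-!
Left-invariant tensor fields on the group are `p ↦ Rot(θ) M Rot(θ)ᵀ` for a constant matrix `M`, so
the differential operators of the statement become algebraic operators on `M`. A rotation of the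
plane and a shear bring every left-invariant metric to a diagonal normal form with coefficients
`A, B, C`. Its Ricci tensor is diagonal in the same frame, so the Ricci flow only moves the
coefficients, and these equations are solved in closed form: `A B` is conserved, and `A`, `B`, `C`
are explicit functions of a solution `y` of `y' = const · (coth y)²`. Along the solution the squared
norm of the Cotton-York tensor times the squared volume density is an increasing polynomial in
`(sinh y)⁻²`, which decreases to zero. Uniqueness holds because the left-invariant flow is an
ordinary differential equation for `M`.
-/

noncomputable section

namespace CottonFlow

open scoped Matrix
/-! ### Orthogonal changes of frame -/

section ChangeOfFrame

variable {ι R : Type*} [Fintype ι] [CommRing R]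

/-- The action of the matrix `Q` on the components of tensors of rank two. -/
def act₂ (Q : Matrix ι ι R) : Matrix ι ι R →ₗ[R] Matrix ι ι R := LinearMap.mulLeftRight R (Q, Qᵀ)

/-- The action of the matrix `Q` on the components of tensors of rank three. -/
def act₃ (Q : Matrix ι ι R) : (ι → ι → ι → R) →ₗ[R] (ι → ι → ι → R) where
  toFun T k i j := ∑ a, Q k a * act₂ Q (Matrix.of (T a)) i j
  map_add' S T := by
    funext k i j
    simp only [Pi.add_apply, ← Matrix.of_add_of, map_add, Matrix.add_apply, mul_add,
      Finset.sum_add_distrib]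
  map_smul' r T := by
    funext k i j
    simp only [Pi.smul_apply, ← Matrix.smul_of, map_smul, Matrix.smul_apply, smul_eq_mul,
      Finset.mul_sum, mul_left_comm, RingHom.id_apply]

theorem act₂_eq_mul (Q M : Matrix ι ι R) : act₂ Q M = Q * M * Qᵀ := by
  simp only [act₂, LinearMap.mulLeftRight_apply]

theorem mul_mul_transpose_apply (P M Q : Matrix ι ι R) (i j : ι) :
    (P * M * Qᵀ) i j = ∑ a, P i a * ∑ b, Q j b * M a b := by
  rw [Matrix.mul_assoc]
  simp only [Matrix.mul_apply, Matrix.transpose_apply, mul_comm (M _ _)]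

theorem act₂_apply (Q M : Matrix ι ι R) (i j : ι) :
    act₂ Q M i j = ∑ a, Q i a * ∑ b, Q j b * M a b := by
  rw [act₂_eq_mul, mul_mul_transpose_apply]

theorem act₂_transpose (Q M : Matrix ι ι R) : act₂ Q Mᵀ = (act₂ Q M)ᵀ := by
  simp only [act₂_eq_mul, Matrix.transpose_mul, Matrix.transpose_transpose, Matrix.mul_assoc]

theorem act₂_apply' (Q M : Matrix ι ι R) (i j : ι) :
    act₂ Q M i j = ∑ b, Q j b * ∑ a, Q i a * M a b := by
  rw [← Matrix.transpose_apply (act₂ Q M), ← act₂_transpose, act₂_apply]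
  rfl

theorem act₂_mul_act₂ (P Q M : Matrix ι ι R) : act₂ P (act₂ Q M) = act₂ (P * Q) M := by
  simp only [act₂_eq_mul, Matrix.transpose_mul, Matrix.mul_assoc]

theorem act₃_apply (Q : Matrix ι ι R) (T : ι → ι → ι → R) (k i j : ι) :
    act₃ Q T k i j = ∑ a, Q k a * act₂ Q (Matrix.of (T a)) i j := rfl

theorem act₃_apply' (Q : Matrix ι ι R) (T : ι → ι → ι → R) (k i j : ι) :
    act₃ Q T k i j = ∑ c, Q j c * act₂ Q (Matrix.of fun a b => T a b c) k i := by
  simp only [act₃_apply, act₂_apply', Matrix.of_apply, Finset.mul_sum]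
  rw [Finset.sum_comm]
  refine Finset.sum_congr rfl fun c _ => ?_
  rw [Finset.sum_comm]
  exact Finset.sum_congr rfl fun b _ => Finset.sum_congr rfl fun a _ => by ring

theorem act₃_comm_left (Q : Matrix ι ι R) (T : ι → ι → ι → R) (k i j : ι) :
    act₃ Q (fun a b c => T b a c) k i j = act₃ Q T i k j := by
  simp only [act₃_apply']
  exact Finset.sum_congr rfl fun c _ => by
    rw [← Matrix.transpose_apply (act₂ Q _) k i, ← act₂_transpose]
    rfl

theorem act₃_comm_right (Q : Matrix ι ι R) (T : ι → ι → ι → R) (k i j : ι) :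
    act₃ Q (fun a b c => T a c b) k i j = act₃ Q T k j i := by
  simp only [act₃_apply]
  exact Finset.sum_congr rfl fun a _ => by
    rw [← Matrix.transpose_apply (act₂ Q _) i j, ← act₂_transpose]
    rfl

theorem act₃_rotate (Q : Matrix ι ι R) (T : ι → ι → ι → R) (k i j : ι) :
    act₃ Q (fun a b c => T c a b) k i j = act₃ Q T j k i := by
  rw [act₃_apply', act₃_apply]

theorem act₂_of_sum_mul {κ : Type*} (s : Finset κ) (Q : Matrix ι ι R) (f : κ → R)
    (X : κ → ι → ι → R) (i j : ι) :
    act₂ Q (Matrix.of fun a b => ∑ d ∈ s, f d * X d a b) i j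
      = ∑ d ∈ s, f d * act₂ Q (Matrix.of (X d)) i j := by
  have h : (Matrix.of fun a b => ∑ d ∈ s, f d * X d a b) = ∑ d ∈ s, f d • Matrix.of (X d) := by
    ext a b
    simp only [Matrix.of_apply, Matrix.sum_apply, Matrix.smul_apply, smul_eq_mul]
  simp only [h, map_sum, map_smul, Matrix.sum_apply, Matrix.smul_apply, smul_eq_mul]

variable [DecidableEq ι]

theorem act₂_one_left (M : Matrix ι ι R) : act₂ 1 M = M := by
  simp only [act₂_eq_mul, Matrix.transpose_one, one_mul, mul_one]

variable {Q : Matrix ι ι R} (hQ : Qᵀ * Q = 1)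
include hQ

theorem act₂_inv (M : Matrix ι ι R) : (act₂ Q M)⁻¹ = act₂ Q M⁻¹ := by
  rw [act₂_eq_mul, Matrix.mul_inv_rev, Matrix.mul_inv_rev, Matrix.inv_eq_left_inv hQ,
    Matrix.inv_eq_right_inv hQ, act₂_eq_mul, Matrix.mul_assoc]

theorem act₂_mul (M N : Matrix ι ι R) : act₂ Q (M * N) = act₂ Q M * act₂ Q N := by
  have h : act₂ Q M * act₂ Q N = Q * M * (Qᵀ * Q) * N * Qᵀ := by
    simp only [act₂_eq_mul, Matrix.mul_assoc]
  rw [h, hQ, Matrix.mul_one, act₂_eq_mul, ← Matrix.mul_assoc Q]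

theorem act₂_det (M : Matrix ι ι R) : (act₂ Q M).det = M.det := by
  rw [act₂_eq_mul, Matrix.det_mul_comm, ← Matrix.mul_assoc, hQ, Matrix.one_mul]

theorem act₂_trace (M : Matrix ι ι R) : (act₂ Q M).trace = M.trace := by
  rw [act₂_eq_mul, Matrix.trace_mul_comm, ← Matrix.mul_assoc, hQ, Matrix.one_mul]

theorem sum_orthogonal_mul (f h : ι → R) :
    ∑ l, (∑ a, Q l a * f a) * ∑ b, Q l b * h b = ∑ a, f a * h a := by
  change (Q *ᵥ f) ⬝ᵥ (Q *ᵥ h) = f ⬝ᵥ h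
  rw [Matrix.dotProduct_mulVec, Matrix.vecMul_mulVec, ← Matrix.dotProduct_mulVec, hQ,
    Matrix.one_mulVec]

theorem act₃_trace (T : ι → ι → ι → R) (k : ι) :
    ∑ i, act₃ Q T i i k = ∑ c, Q k c * ∑ i, T i i c := by
  simp only [act₃_apply']
  rw [Finset.sum_comm]
  refine Finset.sum_congr rfl fun c _ => ?_
  rw [← Finset.mul_sum]
  exact congrArg _ (act₂_trace hQ _)

theorem sum_act₂_mul_act₃ (N : Matrix ι ι R) (T : ι → ι → ι → R) (k i j : ι) :
    ∑ l, act₂ Q N k l * act₃ Q T i j l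
      = act₃ Q (fun k i j => ∑ l, N k l * T i j l) k i j := by
  simp only [act₂_apply' Q N, act₃_apply' Q T, sum_orthogonal_mul hQ]
  simp only [act₃_apply, act₂_of_sum_mul, Finset.mul_sum, Finset.sum_mul, mul_assoc]
  exact Finset.sum_comm

theorem sum_act₃_trace_mul_act₃ (T : ι → ι → ι → R) (j k : ι) :
    ∑ i, ∑ m, act₃ Q T i i m * act₃ Q T m j k
      = act₂ Q (Matrix.of fun a b => ∑ i, ∑ m, T i i m * T m a b) j k := by
  have hswap : ∀ a b, ∑ i, ∑ m, T i i m * T m a b = ∑ m, (∑ i, T i i m) * T m a b := fun a b => by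
    rw [Finset.sum_comm]
    simp only [Finset.sum_mul]
  rw [Finset.sum_comm]
  simp only [← Finset.sum_mul, act₃_trace hQ]
  simp only [act₃_apply, sum_orthogonal_mul hQ, hswap, act₂_of_sum_mul]

theorem sum_act₃_mul_act₃_cross (T : ι → ι → ι → R) (j k : ι) :
    ∑ i, ∑ m, act₃ Q T i j m * act₃ Q T m i k
      = act₂ Q (Matrix.of fun a b => ∑ i, ∑ m, T i a m * T m i b) j k := by
  have hprod : (Matrix.of fun a b => ∑ i, ∑ m, T i a m * T m i b)
      = ∑ m, (Matrix.of fun a b => T a b m)ᵀ * Matrix.of (T m) := by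
    ext a b
    simp only [Matrix.sum_apply, Matrix.mul_apply, Matrix.transpose_apply, Matrix.of_apply]
    exact Finset.sum_comm
  have hcontract : ∀ i, ∑ m, act₃ Q T i j m * act₃ Q T m i k
      = ∑ m, act₂ Q (Matrix.of fun a b => T a b m) i j * act₂ Q (Matrix.of (T m)) i k := fun i => by
    simp only [act₃_apply' Q T i j, act₃_apply Q T _ i k, sum_orthogonal_mul hQ]
  simp only [hcontract, hprod, map_sum, Matrix.sum_apply, act₂_mul hQ, act₂_transpose,
    Matrix.mul_apply, Matrix.transpose_apply]
  exact Finset.sum_comm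

theorem sum_act₃_mul_act₂_left (T : ι → ι → ι → R) (S : Matrix ι ι R) (l i j : ι) :
    ∑ n, act₃ Q T n l i * act₂ Q S n j
      = act₃ Q (fun l i j => ∑ n, T n l i * S n j) l i j := by
  simp only [act₂_apply Q S, act₃_apply Q T, sum_orthogonal_mul hQ]
  simp only [act₃_apply', mul_comm (T _ _ _), act₂_of_sum_mul, Finset.mul_sum]
  rw [Finset.sum_comm]
  exact Finset.sum_congr rfl fun d _ => Finset.sum_congr rfl fun c _ => by ring

theorem sum_act₃_mul_act₂_right (T : ι → ι → ι → R) (S : Matrix ι ι R) (l i j : ι) :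
    ∑ n, act₃ Q T n l j * act₂ Q S i n
      = act₃ Q (fun l i j => ∑ n, T n l j * S i n) l i j := by
  have h := sum_act₃_mul_act₂_left hQ T Sᵀ l j i
  rwa [act₂_transpose, ← act₃_comm_right] at h

end ChangeOfFrame

theorem sum_eta_mul_mul (Q : Matrix (Fin 3) (Fin 3) ℝ) (k a b : Fin 3) :
    ∑ l, ∑ m, eta k l m * (Q l a * Q m b) = ∑ c, Q.adjugate c k * eta c a b := by
  rw [Matrix.adjugate_fin_three]
  fin_cases k <;> fin_cases a <;> fin_cases b <;> simp [eta, Fin.sum_univ_three] <;> ring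

theorem sum_eta_mul_act₂ {Q : Matrix (Fin 3) (Fin 3) ℝ} (hQ : Qᵀ * Q = 1) (hdet : Q.det = 1)
    (S : Matrix (Fin 3) (Fin 3) ℝ) (k : Fin 3) :
    ∑ l, ∑ m, eta k l m * act₂ Q S l m = ∑ c, Q k c * ∑ a, ∑ b, eta c a b * S a b := by
  have hadj : Q.adjugate = Qᵀ := by
    rw [← Q.adjugate.one_mul, ← hQ, Matrix.mul_assoc, Q.mul_adjugate, hdet, one_smul,
      Matrix.mul_one]
  calc ∑ l, ∑ m, eta k l m * act₂ Q S l m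
      = ∑ a, ∑ b, (∑ l, ∑ m, eta k l m * (Q l a * Q m b)) * S a b := by
        simp only [act₂_apply, Fin.sum_univ_three]
        ring
    _ = ∑ a, ∑ b, (∑ c, Q k c * eta c a b) * S a b := by
        simp only [sum_eta_mul_mul, hadj, Matrix.transpose_apply]
    _ = ∑ c, Q k c * ∑ a, ∑ b, eta c a b * S a b := by
        simp only [Fin.sum_univ_three]
        ring

theorem sum_eta_mul_act₃ {Q : Matrix (Fin 3) (Fin 3) ℝ} (hQ : Qᵀ * Q = 1) (hdet : Q.det = 1)
    (T : Fin 3 → Fin 3 → Fin 3 → ℝ) (k j : Fin 3) :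
    ∑ l, ∑ m, eta k l m * act₃ Q T l m j
      = act₂ Q (Matrix.of fun a b => ∑ l, ∑ m, eta a l m * T l m b) k j := by
  have h : ∑ l, ∑ m, eta k l m * act₃ Q T l m j
      = ∑ d, Q j d * ∑ l, ∑ m, eta k l m * act₂ Q (Matrix.of fun a b => T a b d) l m := by
    simp only [act₃_apply', Fin.sum_univ_three]
    ring
  simp only [h, sum_eta_mul_act₂ hQ hdet, Matrix.of_apply]
  rw [act₂_apply']
  rfl

/-! ### Left-invariant tensor fields -/

/-- The rotation of `ℝ³` by the angle `ψ` about the last axis: the differential of the left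
translations by the points with angle `ψ`. -/
def rot (ψ : ℝ) : Matrix (Fin 3) (Fin 3) ℝ :=
  !![Real.cos ψ, -Real.sin ψ, 0; Real.sin ψ, Real.cos ψ, 0; 0, 0, 1]

/-- The infinitesimal generator of the one-parameter group `rot`. -/
def rotGen : Matrix (Fin 3) (Fin 3) ℝ := !![0, -1, 0; 1, 0, 0; 0, 0, 0]

theorem rot_transpose_mul (ψ : ℝ) : (rot ψ)ᵀ * rot ψ = 1 := by
  ext i j
  fin_cases i <;> fin_cases j <;> simp [rot, Matrix.mul_apply, Fin.sum_univ_three] <;>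
    grind [Real.sin_sq_add_cos_sq]

theorem det_rot (ψ : ℝ) : (rot ψ).det = 1 := by
  simp [rot, Matrix.det_fin_three, ← sq]

theorem rot_zero : rot 0 = 1 := by
  ext i j
  fin_cases i <;> fin_cases j <;> simp [rot]

theorem rot_add (a b : ℝ) : rot (a + b) = rot a * rot b := by
  ext i j
  fin_cases i <;> fin_cases j <;>
    simp [rot, Matrix.mul_apply, Fin.sum_univ_three, Real.cos_add, Real.sin_add] <;> ring

theorem rot_apply_two (ψ : ℝ) (l : Fin 3) : rot ψ l 2 = if l = 2 then 1 else 0 := by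
  fin_cases l <;> simp [rot]

theorem rot_two_apply (ψ : ℝ) (l : Fin 3) : rot ψ 2 l = if l = 2 then 1 else 0 := by
  fin_cases l <;> simp [rot]

theorem hasDerivAt_rot (ψ : ℝ) (i a : Fin 3) :
    HasDerivAt (fun s => rot s i a) ((rot ψ * rotGen) i a) ψ := by
  fin_cases i <;> fin_cases a <;>
    simp [rot, rotGen, Matrix.mul_apply, Fin.sum_univ_three, Real.hasDerivAt_cos,
      Real.hasDerivAt_sin, hasDerivAt_const, (Real.hasDerivAt_sin ψ).fun_neg]

/-- The left-invariant field of bilinear forms with components `M` at the points with angle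
`-φ`. -/
def leftInvariantForm (φ : ℝ) (M : Matrix (Fin 3) (Fin 3) ℝ) : Form := fun p =>
  act₂ (rot (p 2 + φ)) M

theorem leftInvariantForm_act₂ (φ ψ : ℝ) (M : Matrix (Fin 3) (Fin 3) ℝ) :
    leftInvariantForm φ (act₂ (rot ψ) M) = leftInvariantForm (φ + ψ) M := by
  funext p
  rw [leftInvariantForm, act₂_mul_act₂, ← rot_add, add_assoc, leftInvariantForm]

/-- The angular derivative of a left-invariant tensor of rank two, at angle zero. -/
def angDeriv₂ (M : Matrix (Fin 3) (Fin 3) ℝ) : Matrix (Fin 3) (Fin 3) ℝ :=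
  rotGen * M + M * rotGenᵀ

/-- The angular derivative of a left-invariant tensor of rank three, at angle zero. -/
def angDeriv₃ (T : Fin 3 → Fin 3 → Fin 3 → ℝ) : Fin 3 → Fin 3 → Fin 3 → ℝ := fun k i j =>
  (∑ a, rotGen k a * T a i j) + angDeriv₂ (Matrix.of (T k)) i j

/-- The differential of a left-invariant tensor of rank two, at angle zero; the first index is the
direction of differentiation. -/
def frameGrad (M : Matrix (Fin 3) (Fin 3) ℝ) : Fin 3 → Fin 3 → Fin 3 → ℝ := fun l i j =>
  if l = 2 then angDeriv₂ M i j else 0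

theorem hasDerivAt_act₂_rot (M : Matrix (Fin 3) (Fin 3) ℝ) (ψ : ℝ) (i j : Fin 3) :
    HasDerivAt (fun s => act₂ (rot s) M i j) (act₂ (rot ψ) (angDeriv₂ M) i j) ψ := by
  have hprod : act₂ (rot ψ) (angDeriv₂ M)
      = rot ψ * rotGen * M * (rot ψ)ᵀ + rot ψ * M * (rot ψ * rotGen)ᵀ := by
    simp only [act₂_eq_mul, angDeriv₂, Matrix.transpose_mul, Matrix.mul_add, Matrix.add_mul,
      Matrix.mul_assoc]
  have hderiv : act₂ (rot ψ) (angDeriv₂ M) i j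
      = ∑ a, ((rot ψ * rotGen) i a * (∑ b, rot ψ j b * M a b)
        + rot ψ i a * ∑ b, (rot ψ * rotGen) j b * M a b) := by
    rw [hprod, Matrix.add_apply, mul_mul_transpose_apply, mul_mul_transpose_apply,
      Finset.sum_add_distrib]
  simp only [hderiv, act₂_apply]
  exact HasDerivAt.fun_sum fun a _ => (hasDerivAt_rot ψ i a).mul
    (HasDerivAt.fun_sum fun b _ => (hasDerivAt_rot ψ j b).mul_const _)

theorem hasDerivAt_act₃_rot (T : Fin 3 → Fin 3 → Fin 3 → ℝ) (ψ : ℝ) (k i j : Fin 3) :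
    HasDerivAt (fun s => act₃ (rot s) T k i j) (act₃ (rot ψ) (angDeriv₃ T) k i j) ψ := by
  have hangle : ∀ a, Matrix.of (angDeriv₃ T a)
      = (Matrix.of fun i j => ∑ b, rotGen a b * T b i j) + angDeriv₂ (Matrix.of (T a)) :=
    fun _ => rfl
  have hderiv : act₃ (rot ψ) (angDeriv₃ T) k i j
      = ∑ a, ((rot ψ * rotGen) k a * act₂ (rot ψ) (Matrix.of (T a)) i j
        + rot ψ k a * act₂ (rot ψ) (angDeriv₂ (Matrix.of (T a))) i j) := by
    simp only [act₃_apply, hangle, map_add, Matrix.add_apply, act₂_of_sum_mul, mul_add,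
      Finset.sum_add_distrib, Matrix.mul_apply, Finset.sum_mul, Finset.mul_sum, mul_assoc]
    rw [Finset.sum_comm]
  simp only [hderiv, act₃_apply]
  exact HasDerivAt.fun_sum fun a _ => (hasDerivAt_rot ψ k a).mul (hasDerivAt_act₂_rot _ ψ i j)

theorem pd_comp_angle {f : ℝ → ℝ} {f' φ : ℝ} {p : Pt} (h : HasDerivAt f f' (p 2 + φ))
    (l : Fin 3) : pd l (fun q => f (q 2 + φ)) p = if l = 2 then f' else 0 := by
  have hangle : HasFDerivAt (fun q : Pt => q 2 + φ)
      (ContinuousLinearMap.proj (R := ℝ) (φ := fun _ : Fin 3 => ℝ) 2) p :=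
    (hasFDerivAt_apply (𝕜 := ℝ) (2 : Fin 3) p).add_const φ
  have hcomp := h.comp_hasFDerivAt p hangle
  rw [pd, show (fun q : Pt => f (q 2 + φ)) = f ∘ fun q : Pt => q 2 + φ from rfl, hcomp.fderiv]
  fin_cases l <;> simp

theorem pd_leftInvariantForm (φ : ℝ) (M : Matrix (Fin 3) (Fin 3) ℝ) (l i j : Fin 3) (p : Pt) :
    pd l (fun q => leftInvariantForm φ M q i j) p = act₃ (rot (p 2 + φ)) (frameGrad M) l i j := by
  have hgrad : act₃ (rot (p 2 + φ)) (frameGrad M) l i j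
      = rot (p 2 + φ) l 2 * act₂ (rot (p 2 + φ)) (angDeriv₂ M) i j := by
    have hzero : ∀ l : Fin 3, l ≠ 2 → Matrix.of (frameGrad M l) = 0 := fun l hl => by
      ext a b
      simp only [frameGrad, Matrix.of_apply, if_neg hl, Matrix.zero_apply]
    rw [act₃_apply, Fin.sum_univ_three, hzero 0 (by decide), hzero 1 (by decide)]
    simp only [map_zero, Matrix.zero_apply, mul_zero, zero_add]
    rfl
  rw [hgrad, rot_apply_two, ite_mul, one_mul, zero_mul]
  exact pd_comp_angle (hasDerivAt_act₂_rot M (p 2 + φ) i j) l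

/-! ### Curvature of left-invariant metrics -/

/-- The Christoffel symbols `Γᵏᵢⱼ`, as `frameChristoffel M k i j`, of `leftInvariantForm φ M` at
angle zero. -/
def frameChristoffel (M : Matrix (Fin 3) (Fin 3) ℝ) : Fin 3 → Fin 3 → Fin 3 → ℝ := fun k i j =>
  (1 / 2) * ∑ l, M⁻¹ k l * (frameGrad M i j l + frameGrad M j i l - frameGrad M l i j)

/-- The Ricci tensor of `leftInvariantForm φ M`, at angle zero. -/
def frameRicci (M : Matrix (Fin 3) (Fin 3) ℝ) : Matrix (Fin 3) (Fin 3) ℝ :=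
  let Γ := frameChristoffel M
  Matrix.of fun j k =>
    angDeriv₃ Γ 2 j k - (if j = 2 then ∑ i, angDeriv₃ Γ i i k else 0)
      + (∑ i, ∑ m, Γ i i m * Γ m j k - ∑ i, ∑ m, Γ i j m * Γ m i k)

/-- The covariant derivative of `leftInvariantForm φ S` with respect to the metric
`leftInvariantForm φ M`, at angle zero; the first index is the direction of differentiation. -/
def frameCovDeriv (M S : Matrix (Fin 3) (Fin 3) ℝ) : Fin 3 → Fin 3 → Fin 3 → ℝ := fun l i j =>
  frameGrad S l i j
    - (∑ n, frameChristoffel M n l i * S n j + ∑ n, frameChristoffel M n l j * S i n)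

/-- The Cotton-York tensor of `leftInvariantForm φ M`, at angle zero; the scalar curvature is
constant and does not contribute. -/
def frameCottonYork (M : Matrix (Fin 3) (Fin 3) ℝ) : Matrix (Fin 3) (Fin 3) ℝ :=
  (Real.sqrt M.det)⁻¹ •
    (M * Matrix.of fun k j => ∑ l, ∑ m, eta k l m * frameCovDeriv M (frameRicci M) l m j)

theorem christoffel_leftInvariantForm (φ : ℝ) (M : Matrix (Fin 3) (Fin 3) ℝ) (k i j : Fin 3)
    (p : Pt) : christoffel (leftInvariantForm φ M) k i j p
      = act₃ (rot (p 2 + φ)) (frameChristoffel M) k i j := by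
  have hQ := rot_transpose_mul (p 2 + φ)
  have hframe : frameChristoffel M = (1 / 2 : ℝ) • fun k i j => ∑ l, M⁻¹ k l *
      ((frameGrad M + (fun a b c => frameGrad M b a c) - fun a b c => frameGrad M c a b) i j l) :=
    rfl
  rw [hframe, map_smul, Pi.smul_apply, Pi.smul_apply, Pi.smul_apply, smul_eq_mul,
    ← sum_act₂_mul_act₃ hQ, christoffel]
  refine congrArg _ (Finset.sum_congr rfl fun l _ => ?_)
  simp only [pd_leftInvariantForm]
  rw [leftInvariantForm, act₂_inv hQ, ← act₃_rotate _ _ i j l, ← act₃_comm_left _ _ i j l,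
    map_sub, map_add]
  rfl

theorem sum_pd_act₃_rot_left (T : Fin 3 → Fin 3 → Fin 3 → ℝ) (φ : ℝ) (j k : Fin 3) (p : Pt) :
    ∑ i, pd i (fun q => act₃ (rot (q 2 + φ)) T i j k) p
      = act₂ (rot (p 2 + φ)) (Matrix.of (angDeriv₃ T 2)) j k := by
  have htwo : act₃ (rot (p 2 + φ)) (angDeriv₃ T) 2 j k
      = act₂ (rot (p 2 + φ)) (Matrix.of (angDeriv₃ T 2)) j k := by
    simp only [act₃_apply, rot_two_apply, ite_mul, one_mul, zero_mul, Finset.sum_ite_eq',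
      Finset.mem_univ, if_true]
  simp only [pd_comp_angle (hasDerivAt_act₃_rot T (p 2 + φ) _ j k), Finset.sum_ite_eq',
    Finset.mem_univ, if_true, htwo]

theorem sum_pd_act₃_rot_trace (T : Fin 3 → Fin 3 → Fin 3 → ℝ) (φ : ℝ) (j k : Fin 3) (p : Pt) :
    ∑ i, pd j (fun q => act₃ (rot (q 2 + φ)) T i i k) p
      = act₂ (rot (p 2 + φ))
          (Matrix.of fun a b => if a = 2 then ∑ i, angDeriv₃ T i i b else 0) j k := by
  simp only [pd_comp_angle (hasDerivAt_act₃_rot T (p 2 + φ) _ _ k), act₂_apply', Matrix.of_apply]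
  simp only [mul_ite, mul_zero, Finset.sum_ite_eq', Finset.mem_univ, if_true, rot_apply_two]
  split_ifs with hj
  · simp only [act₃_trace (rot_transpose_mul _), one_mul]
  · simp only [zero_mul, mul_zero, Finset.sum_const_zero]

theorem ricci_leftInvariantForm (φ : ℝ) (M : Matrix (Fin 3) (Fin 3) ℝ) :
    ricci (leftInvariantForm φ M) = leftInvariantForm φ (frameRicci M) := by
  have hframe : frameRicci M
      = Matrix.of (angDeriv₃ (frameChristoffel M) 2)
        - Matrix.of (fun a b => if a = 2 then ∑ i, angDeriv₃ (frameChristoffel M) i i b else 0)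
        + (Matrix.of (fun a b => ∑ i, ∑ m, frameChristoffel M i i m * frameChristoffel M m a b)
          - Matrix.of fun a b => ∑ i, ∑ m, frameChristoffel M i a m * frameChristoffel M m i b) :=
    rfl
  have hΓ : ∀ k i j, christoffel (leftInvariantForm φ M) k i j
      = fun p => act₃ (rot (p 2 + φ)) (frameChristoffel M) k i j := fun k i j =>
    funext fun p => christoffel_leftInvariantForm φ M k i j p
  funext p
  ext j k
  simp only [ricci, riemann, hΓ, Finset.sum_add_distrib, Finset.sum_sub_distrib,
    sum_pd_act₃_rot_left, sum_pd_act₃_rot_trace, sum_act₃_trace_mul_act₃ (rot_transpose_mul _),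
    sum_act₃_mul_act₃_cross (rot_transpose_mul _), leftInvariantForm, hframe, map_add, map_sub,
    Matrix.add_apply, Matrix.sub_apply]

theorem scalar_leftInvariantForm (φ : ℝ) (M : Matrix (Fin 3) (Fin 3) ℝ) (p : Pt) :
    scalar (leftInvariantForm φ M) p = ((M⁻¹)ᵀ * frameRicci M).trace := by
  have hscalar : ∀ g p, scalar g p = (((g p)⁻¹)ᵀ * ricci g p).trace := fun g p => by
    simp only [scalar, Matrix.trace, Matrix.diag, Matrix.mul_apply, Matrix.transpose_apply]
    exact Finset.sum_comm
  have hQ := rot_transpose_mul (p 2 + φ)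
  rw [hscalar, ricci_leftInvariantForm, leftInvariantForm, leftInvariantForm, act₂_inv hQ,
    ← act₂_transpose, ← act₂_mul hQ, act₂_trace hQ]

theorem covDeriv_leftInvariantForm (φ : ℝ) (M S : Matrix (Fin 3) (Fin 3) ℝ) (l i j : Fin 3)
    (p : Pt) : covDeriv (leftInvariantForm φ M) (leftInvariantForm φ S) l i j p
      = act₃ (rot (p 2 + φ)) (frameCovDeriv M S) l i j := by
  have hframe : frameCovDeriv M S
      = frameGrad S - ((fun l i j => ∑ n, frameChristoffel M n l i * S n j)
        + fun l i j => ∑ n, frameChristoffel M n l j * S i n) := rfl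
  simp only [covDeriv, pd_leftInvariantForm, christoffel_leftInvariantForm, Finset.sum_add_distrib]
  simp only [leftInvariantForm, sum_act₃_mul_act₂_left (rot_transpose_mul _),
    sum_act₃_mul_act₂_right (rot_transpose_mul _), hframe, map_sub, map_add, Pi.sub_apply,
    Pi.add_apply]

theorem cottonYork_leftInvariantForm (φ : ℝ) (M : Matrix (Fin 3) (Fin 3) ℝ) :
    cottonYork (leftInvariantForm φ M) = leftInvariantForm φ (frameCottonYork M) := by
  have hscalar : ∀ l p, pd l (scalar (leftInvariantForm φ M)) p = 0 := fun l p => by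
    rw [pd, funext (scalar_leftInvariantForm φ M), fderiv_const_apply, zero_apply]
  have hfactor : ∀ a b c d : ℝ, a * (b / c) * d = c⁻¹ * (a * (b * d)) := fun a b c d => by ring
  funext p
  have hQ := rot_transpose_mul (p 2 + φ)
  ext i j
  simp only [cottonYork, ricci_leftInvariantForm, hscalar, covDeriv_leftInvariantForm, mul_zero,
    zero_mul, sub_zero, hfactor, ← Finset.mul_sum, sum_eta_mul_act₃ hQ (det_rot _)]
  simp only [leftInvariantForm, frameCottonYork, map_smul, act₂_det hQ, act₂_mul hQ,
    Matrix.smul_apply, Matrix.mul_apply, smul_eq_mul]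

theorem tensorNorm_leftInvariantForm (φ : ℝ) (M S : Matrix (Fin 3) (Fin 3) ℝ) (p : Pt) :
    tensorNorm (leftInvariantForm φ M) (leftInvariantForm φ S) p
      = Real.sqrt ((M⁻¹)ᵀ * S * M⁻¹ * Sᵀ).trace := by
  have htrace : ∀ N S : Matrix (Fin 3) (Fin 3) ℝ,
      ∑ i, ∑ j, ∑ a, ∑ b, N i a * N j b * S i j * S a b = (Nᵀ * S * N * Sᵀ).trace := fun N S => by
    simp only [Matrix.trace, Matrix.diag, Matrix.mul_apply, Matrix.transpose_apply,
      Fin.sum_univ_three]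
    ring
  have hQ := rot_transpose_mul (p 2 + φ)
  rw [tensorNorm, htrace, leftInvariantForm, leftInvariantForm, act₂_inv hQ]
  simp only [← act₂_transpose, ← act₂_mul hQ, act₂_trace hQ]

theorem det_leftInvariantForm (φ : ℝ) (M : Matrix (Fin 3) (Fin 3) ℝ) (p : Pt) :
    (leftInvariantForm φ M p).det = M.det := by
  rw [leftInvariantForm, act₂_det (rot_transpose_mul _)]

theorem cottonYorkL1_leftInvariantForm (K : Set Pt) (φ : ℝ) (M : Matrix (Fin 3) (Fin 3) ℝ) :
    cottonYorkL1 K (leftInvariantForm φ M) = volume.real K *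
      (Real.sqrt ((M⁻¹)ᵀ * frameCottonYork M * M⁻¹ * (frameCottonYork M)ᵀ).trace
        * Real.sqrt M.det) := by
  simp only [cottonYorkL1, cottonYork_leftInvariantForm, tensorNorm_leftInvariantForm,
    det_leftInvariantForm, setIntegral_const, smul_eq_mul]

/-! ### Curvature of the normal form -/

/-- The matrix of `A (dx - v dθ)² + B (dy - w dθ)² + C dθ²`, to which every left-invariant metric
can be brought by a rotation. -/
def diagForm (v w A B C : ℝ) : Matrix (Fin 3) (Fin 3) ℝ :=
  !![A, 0, -(A * v); 0, B, -(B * w); -(A * v), -(B * w), A * v ^ 2 + B * w ^ 2 + C]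

theorem det_diagForm (v w A B C : ℝ) : (diagForm v w A B C).det = A * B * C := by
  simp [diagForm, Matrix.det_fin_three]
  ring

theorem diagForm_inv (v w : ℝ) {A B C : ℝ} (hA : A ≠ 0) (hB : B ≠ 0) (hC : C ≠ 0) :
    (diagForm v w A B C)⁻¹ = !![A⁻¹ + v ^ 2 * C⁻¹, v * w * C⁻¹, v * C⁻¹;
      v * w * C⁻¹, B⁻¹ + w ^ 2 * C⁻¹, w * C⁻¹; v * C⁻¹, w * C⁻¹, C⁻¹] := by
  apply Matrix.inv_eq_left_inv
  ext i j
  fin_cases i <;> fin_cases j <;> simp [diagForm, Matrix.mul_apply, Fin.sum_univ_three] <;> field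

theorem angDeriv₂_diagForm (v w A B C : ℝ) : angDeriv₂ (diagForm v w A B C)
    = !![0, A - B, B * w; A - B, 0, -(A * v); B * w, -(A * v), 0] := by
  ext i j
  fin_cases i <;> fin_cases j <;>
    simp [angDeriv₂, rotGen, diagForm, Matrix.vecMul] <;> ring

/-- The Christoffel symbols of `diagForm v w A B C`, at angle zero. -/
def diagChristoffel (v w A B C : ℝ) : Fin 3 → Fin 3 → Fin 3 → ℝ :=
  ![!![0, -(v * (A - B) / (2 * C)), v * w * (A - B) / (2 * C);
      -(v * (A - B) / (2 * C)), 0, (A - B) * (A⁻¹ + v ^ 2 * C⁻¹) / 2;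
      v * w * (A - B) / (2 * C), (A - B) * (A⁻¹ + v ^ 2 * C⁻¹) / 2,
        B * w / A - v ^ 2 * w * (A - B) / C],
    !![0, -(w * (A - B) / (2 * C)), (A - B) * (B⁻¹ + w ^ 2 * C⁻¹) / 2;
      -(w * (A - B) / (2 * C)), 0, v * w * (A - B) / (2 * C);
      (A - B) * (B⁻¹ + w ^ 2 * C⁻¹) / 2, v * w * (A - B) / (2 * C),
        -(A * v / B) - v * w ^ 2 * (A - B) / C],
    !![0, -((A - B) / (2 * C)), w * (A - B) / (2 * C);
      -((A - B) / (2 * C)), 0, v * (A - B) / (2 * C);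
      w * (A - B) / (2 * C), v * (A - B) / (2 * C), -(v * w * (A - B) / C)]]

theorem frameChristoffel_diagForm (v w : ℝ) {A B C : ℝ} (hA : A ≠ 0) (hB : B ≠ 0) (hC : C ≠ 0) :
    frameChristoffel (diagForm v w A B C) = diagChristoffel v w A B C := by
  funext k i j
  simp only [frameChristoffel, frameGrad, angDeriv₂_diagForm, diagForm_inv v w hA hB hC,
    Fin.sum_univ_three]
  fin_cases k <;> fin_cases i <;> fin_cases j <;> simp [diagChristoffel] <;> field

theorem frameRicci_diagForm (v w : ℝ) {A B C : ℝ} (hA : A ≠ 0) (hB : B ≠ 0) (hC : C ≠ 0) :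
    frameRicci (diagForm v w A B C) = diagForm v w ((A ^ 2 - B ^ 2) / (2 * B * C))
      ((B ^ 2 - A ^ 2) / (2 * A * C)) (-((A - B) ^ 2 / (2 * A * B))) := by
  ext j k
  simp only [frameRicci, frameChristoffel_diagForm v w hA hB hC, angDeriv₃, angDeriv₂,
    Matrix.add_apply, Matrix.mul_apply, Matrix.transpose_apply, Matrix.of_apply,
    Fin.sum_univ_three]
  fin_cases j <;> fin_cases k <;> simp [diagChristoffel, rotGen, diagForm] <;> field

theorem frameCottonYork_diagForm (v w : ℝ) {A B C : ℝ} (hA : A ≠ 0) (hB : B ≠ 0) (hC : C ≠ 0) :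
    frameCottonYork (diagForm v w A B C) = (Real.sqrt (A * B * C))⁻¹ •
      diagForm v w (-((A - B) * (2 * A ^ 2 + A * B + B ^ 2) / (2 * B * C)))
        ((A - B) * (A ^ 2 + A * B + 2 * B ^ 2) / (2 * A * C))
        ((A - B) ^ 2 * (A + B) / (2 * A * B)) := by
  rw [frameCottonYork, det_diagForm]
  congr 1
  ext k j
  simp only [Matrix.mul_apply, frameCovDeriv, frameRicci_diagForm v w hA hB hC,
    frameChristoffel_diagForm v w hA hB hC, Matrix.of_apply, frameGrad, angDeriv₂_diagForm,
    Fin.sum_univ_three]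
  fin_cases k <;> fin_cases j <;> simp [diagChristoffel, eta, diagForm] <;> field

theorem diagForm_inv_mul (v w : ℝ) {A B C : ℝ} (hA : A ≠ 0) (hB : B ≠ 0) (hC : C ≠ 0)
    (a b c : ℝ) : (diagForm v w A B C)⁻¹ * diagForm v w a b c
      = !![a / A, 0, v * (c / C - a / A); 0, b / B, w * (c / C - b / B); 0, 0, c / C] := by
  rw [diagForm_inv v w hA hB hC]
  ext i j
  fin_cases i <;> fin_cases j <;> simp [diagForm, Matrix.mul_apply, Fin.sum_univ_three] <;> field

theorem diagForm_transpose (v w A B C : ℝ) : (diagForm v w A B C)ᵀ = diagForm v w A B C := by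
  ext i j
  fin_cases i <;> fin_cases j <;> rfl

theorem trace_diagForm_norm (v w : ℝ) {A B C : ℝ} (hA : A ≠ 0) (hB : B ≠ 0) (hC : C ≠ 0)
    (r a b c : ℝ) :
    (((diagForm v w A B C)⁻¹)ᵀ * (r • diagForm v w a b c) * (diagForm v w A B C)⁻¹ *
      (r • diagForm v w a b c)ᵀ).trace
        = r ^ 2 * ((a / A) ^ 2 + (b / B) ^ 2 + (c / C) ^ 2) := by
  rw [Matrix.transpose_nonsing_inv, Matrix.mul_assoc, Matrix.transpose_smul, Matrix.mul_smul,
    Matrix.mul_smul, diagForm_transpose, diagForm_transpose, diagForm_inv_mul v w hA hB hC]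
  simp [Matrix.trace, Fin.sum_univ_three]
  ring

/-- The square of the pointwise integrand of `C_K` (norm of the Cotton-York tensor times volume
density) for the metric `diagForm v w A B C`. -/
def cottonDensitySq (A B C : ℝ) : ℝ :=
  (A - B) ^ 2 * (3 * (A ^ 2 + B ^ 2) ^ 2 + 3 * (A * B) * (A ^ 2 + B ^ 2) - 2 * (A * B) ^ 2)
    / (2 * (A * B) ^ 2 * C ^ 2)

theorem cottonYorkL1_diagForm (K : Set Pt) (φ v w : ℝ) {A B C : ℝ} (hA : 0 < A) (hB : 0 < B)
    (hC : 0 < C) : cottonYorkL1 K (leftInvariantForm φ (diagForm v w A B C))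
      = volume.real K * Real.sqrt (cottonDensitySq A B C) := by
  have hdet : 0 < A * B * C := by positivity
  rw [cottonYorkL1_leftInvariantForm, frameCottonYork_diagForm v w hA.ne' hB.ne' hC.ne',
    trace_diagForm_norm v w hA.ne' hB.ne' hC.ne', det_diagForm, ← Real.sqrt_mul' _ hdet.le,
    inv_pow, Real.sq_sqrt hdet.le, cottonDensitySq]
  congr 2
  field

/-! ### Solution of the coefficient equations -/

theorem hasDerivAt_sub_tanh (y : ℝ) :
    HasDerivAt (fun y => y - Real.tanh y) (Real.tanh y ^ 2) y := by
  have htanh : HasDerivAt Real.tanh (1 - Real.tanh y ^ 2) y := by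
    rw [funext Real.tanh_eq_sinh_div_cosh]
    refine ((Real.hasDerivAt_sinh y).fun_div (Real.hasDerivAt_cosh y)
      (Real.cosh_pos y).ne').congr_deriv ?_
    have := (Real.cosh_pos y).ne'
    field
  exact ((hasDerivAt_id' y).fun_sub htanh).congr_deriv (sub_sub_cancel 1 _)

theorem continuous_sub_tanh : Continuous fun y : ℝ => y - Real.tanh y :=
  continuous_iff_continuousAt.2 fun y => (hasDerivAt_sub_tanh y).continuousAt

theorem tanh_sq_pos {y : ℝ} (hy : y ≠ 0) : 0 < Real.tanh y ^ 2 := by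
  rw [Real.tanh_eq_sinh_div_cosh]
  exact sq_pos_of_ne_zero (div_ne_zero (Real.sinh_ne_zero.2 hy) (Real.cosh_pos y).ne')

theorem strictMono_sub_tanh : StrictMono fun y : ℝ => y - Real.tanh y := by
  refine StrictMonoOn.Iic_union_Ici (a := 0)
    (strictMonoOn_of_deriv_pos (convex_Iic 0) continuous_sub_tanh.continuousOn fun y hy => ?_)
    (strictMonoOn_of_deriv_pos (convex_Ici 0) continuous_sub_tanh.continuousOn fun y hy => ?_)
  · rw [interior_Iic] at hy
    exact (hasDerivAt_sub_tanh y).deriv ▸ tanh_sq_pos (ne_of_lt hy)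
  · rw [interior_Ici] at hy
    exact (hasDerivAt_sub_tanh y).deriv ▸ tanh_sq_pos (ne_of_gt hy)

theorem surjective_sub_tanh : Function.Surjective fun y : ℝ => y - Real.tanh y :=
  continuous_sub_tanh.surjective
    (tendsto_atTop_mono (fun y => sub_le_sub_left (Real.tanh_lt_one y).le y)
      (tendsto_atTop_add_const_right atTop (-1 : ℝ) tendsto_id))
    (tendsto_atBot_mono (fun y => sub_le_sub_left (Real.neg_one_lt_tanh y).le y)
      (tendsto_atBot_add_const_right atBot (- -1 : ℝ) tendsto_id))

/-- The map `y ↦ y - tanh y`, as an order isomorphism; its inverse is the time change that solves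
the coefficient equations. -/
def subTanh : ℝ ≃o ℝ :=
  StrictMono.orderIsoOfSurjective _ strictMono_sub_tanh surjective_sub_tanh

theorem subTanh_apply (y : ℝ) : subTanh y = y - Real.tanh y := rfl

theorem subTanh_zero : subTanh 0 = 0 := by rw [subTanh_apply, Real.tanh_zero, sub_zero]

theorem subTanh_pos {y : ℝ} (hy : 0 < y) : 0 < subTanh y :=
  subTanh_zero ▸ subTanh.lt_iff_lt.2 hy

theorem subTanh_symm_pos {x : ℝ} (hx : 0 < x) : 0 < subTanh.symm x := by
  rwa [← subTanh.lt_iff_lt, OrderIso.apply_symm_apply, subTanh_zero]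

theorem hasDerivAt_subTanh_symm {x : ℝ} (hx : 0 < x) :
    HasDerivAt subTanh.symm (Real.tanh (subTanh.symm x) ^ 2)⁻¹ x :=
  HasDerivAt.of_local_left_inverse (f := fun y => y - Real.tanh y)
    subTanh.symm.continuous.continuousAt (hasDerivAt_sub_tanh _)
    (tanh_sq_pos (subTanh_symm_pos hx).ne').ne'
    (Eventually.of_forall fun z => subTanh.apply_symm_apply z)

/-- The solution `y` of `y' = (4 / κ) (coth y) ^ 2` with `y 0 = y₀`, where `y₀` and `κ` are
positive. -/
def flowParam (κ y₀ t : ℝ) : ℝ := subTanh.symm (4 / κ * t + subTanh y₀)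

theorem flowParam_zero (κ y₀ : ℝ) : flowParam κ y₀ 0 = y₀ := by
  rw [flowParam, mul_zero, zero_add, OrderIso.symm_apply_apply]

section FlowParam

variable {κ y₀ : ℝ}

theorem flowParam_pos (hκ : 0 < κ) (hy : 0 < y₀) {t : ℝ} (ht : 0 ≤ t) : 0 < flowParam κ y₀ t := by
  have := subTanh_pos hy
  exact subTanh_symm_pos (by positivity)

theorem strictMono_flowParam (hκ : 0 < κ) (y₀ : ℝ) : StrictMono (flowParam κ y₀) := fun s t h =>
  subTanh.symm.strictMono (by gcongr)

theorem tendsto_flowParam (hκ : 0 < κ) (y₀ : ℝ) : Tendsto (flowParam κ y₀) atTop atTop :=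
  subTanh.symm.tendsto_atTop.comp
    (tendsto_atTop_add_const_right _ _ (tendsto_id.const_mul_atTop (by positivity)))

theorem hasDerivAt_flowParam (hκ : 0 < κ) (hy : 0 < y₀) {t : ℝ} (ht : 0 ≤ t) :
    HasDerivAt (flowParam κ y₀)
      (4 / κ * (Real.cosh (flowParam κ y₀ t) / Real.sinh (flowParam κ y₀ t)) ^ 2) t := by
  have hsub := subTanh_pos hy
  have hlin : HasDerivAt (fun t => 4 / κ * t + subTanh y₀) (4 / κ) t := by
    simpa using ((hasDerivAt_id t).const_mul (4 / κ)).add_const (subTanh y₀)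
  have hcomp := (hasDerivAt_subTanh_symm (x := 4 / κ * t + subTanh y₀) (by positivity)).comp t hlin
  refine hcomp.congr_deriv ?_
  rw [Real.tanh_eq_sinh_div_cosh, flowParam, ← inv_pow, inv_div, mul_comm]

theorem strictAntiOn_inv_sinh_sq_flowParam (hκ : 0 < κ) (hy : 0 < y₀) :
    StrictAntiOn (fun t => (Real.sinh (flowParam κ y₀ t) ^ 2)⁻¹) (Ici 0) := by
  intro s hs t _ hst
  have hpos := Real.sinh_pos_iff.2 (flowParam_pos hκ hy hs)
  have hlt := Real.sinh_lt_sinh.2 (strictMono_flowParam hκ y₀ hst)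
  dsimp only
  gcongr

theorem tendsto_inv_sinh_sq_flowParam (hκ : 0 < κ) (hy : 0 < y₀) :
    Tendsto (fun t => (Real.sinh (flowParam κ y₀ t) ^ 2)⁻¹) atTop (𝓝 0) := by
  have hsinh : Tendsto (fun t => Real.sinh (flowParam κ y₀ t)) atTop atTop :=
    tendsto_atTop_mono' _ ((eventually_ge_atTop 0).mono fun t ht =>
      Real.self_le_sinh_iff.2 (flowParam_pos hκ hy ht).le) (tendsto_flowParam hκ y₀)
  exact tendsto_inv_atTop_zero.comp ((tendsto_pow_atTop two_ne_zero).comp hsinh)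

end FlowParam

/-- The Ricci flow equations for the coefficients of `diagForm v w A B C`. -/
structure IsCoefficientFlow (a b c : ℝ → ℝ) : Prop where
  pos : ∀ t, 0 ≤ t → 0 < a t ∧ 0 < b t ∧ 0 < c t
  deriv_a : ∀ t, 0 ≤ t → HasDerivAt a (-2 * ((a t ^ 2 - b t ^ 2) / (2 * b t * c t))) t
  deriv_b : ∀ t, 0 ≤ t → HasDerivAt b (-2 * ((b t ^ 2 - a t ^ 2) / (2 * a t * c t))) t
  deriv_c : ∀ t, 0 ≤ t → HasDerivAt c (-2 * (-((a t - b t) ^ 2 / (2 * a t * b t)))) t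

theorem IsCoefficientFlow.swap {a b c : ℝ → ℝ} (h : IsCoefficientFlow a b c) :
    IsCoefficientFlow b a c where
  pos t ht := ⟨(h.pos t ht).2.1, (h.pos t ht).1, (h.pos t ht).2.2⟩
  deriv_a := h.deriv_b
  deriv_b := h.deriv_a
  deriv_c t ht := (h.deriv_c t ht).congr_deriv (by rw [sub_sq_comm, mul_right_comm])

theorem isCoefficientFlow_const {A C : ℝ} (hA : 0 < A) (hC : 0 < C) :
    IsCoefficientFlow (fun _ => A) (fun _ => A) (fun _ => C) where
  pos _ _ := ⟨hA, hA, hC⟩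
  deriv_a t _ := by simpa using hasDerivAt_const t A
  deriv_b t _ := by simpa using hasDerivAt_const t A
  deriv_c t _ := by simpa using hasDerivAt_const t C

-- The product `a b = k ^ 2` is conserved, so `a` and `b` can be written as `k (coth (y / 2)) ^ ±1`.
theorem isCoefficientFlow_flowParam {k κ y₀ : ℝ} (hk : 0 < k) (hκ : 0 < κ) (hy : 0 < y₀) :
    IsCoefficientFlow
      (fun t => k * (Real.cosh (flowParam κ y₀ t) + 1) / Real.sinh (flowParam κ y₀ t))
      (fun t => k * (Real.cosh (flowParam κ y₀ t) - 1) / Real.sinh (flowParam κ y₀ t))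
      (fun t => κ * Real.sinh (flowParam κ y₀ t) / Real.cosh (flowParam κ y₀ t)) := by
  have hsinh : ∀ t, 0 ≤ t → 0 < Real.sinh (flowParam κ y₀ t) := fun t ht =>
    Real.sinh_pos_iff.2 (flowParam_pos hκ hy ht)
  have hcosh : ∀ t, 0 ≤ t → 0 < Real.cosh (flowParam κ y₀ t) - 1 := fun t ht =>
    sub_pos.2 (Real.one_lt_cosh.2 (flowParam_pos hκ hy ht).ne')
  have hsq := fun t => Real.cosh_sq (flowParam κ y₀ t)
  have hderiv_sinh := fun t ht => (hasDerivAt_flowParam hκ hy (t := t) ht).sinh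
  have hderiv_cosh := fun t ht => (hasDerivAt_flowParam hκ hy (t := t) ht).cosh
  refine ⟨fun t ht => ?_, fun t ht => ?_, fun t ht => ?_, fun t ht => ?_⟩ <;>
    specialize hsinh t ht <;> specialize hcosh t ht <;> specialize hsq t <;>
    have hcosh₀ := Real.cosh_pos (flowParam κ y₀ t)
  · exact ⟨by positivity, by positivity, by positivity⟩
  · refine ((((hderiv_cosh t ht).add_const 1).const_mul k).fun_div (hderiv_sinh t ht)
      hsinh.ne').congr_deriv ?_
    field_simp
    grind
  · refine ((((hderiv_cosh t ht).sub_const 1).const_mul k).fun_div (hderiv_sinh t ht)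
      hsinh.ne').congr_deriv ?_
    field_simp
    grind
  · refine (((hderiv_sinh t ht).const_mul κ).fun_div (hderiv_cosh t ht)
      hcosh₀.ne').congr_deriv ?_
    field_simp
    grind

theorem cottonDensitySq_self (A C : ℝ) : cottonDensitySq A A C = 0 := by
  simp [cottonDensitySq]

theorem cottonDensitySq_comm (A B C : ℝ) : cottonDensitySq A B C = cottonDensitySq B A C := by
  simp only [cottonDensitySq, sub_sq_comm A B, mul_comm A B, add_comm (A ^ 2) (B ^ 2)]

theorem cottonDensitySq_nonneg (A B C : ℝ) : 0 ≤ cottonDensitySq A B C := by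
  have hpoly : 3 * (A ^ 2 + B ^ 2) ^ 2 + 3 * (A * B) * (A ^ 2 + B ^ 2) - 2 * (A * B) ^ 2
      = (3 / 2) * (A + B) ^ 2 * (A ^ 2 + B ^ 2) + (3 / 2) * (A ^ 2 - B ^ 2) ^ 2
        + 4 * (A * B) ^ 2 := by ring
  rw [cottonDensitySq, hpoly]
  positivity

theorem cottonDensitySq_of_sinh {k κ y : ℝ} (hk : k ≠ 0) (hκ : κ ≠ 0) (hy : y ≠ 0) :
    cottonDensitySq (k * (Real.cosh y + 1) / Real.sinh y) (k * (Real.cosh y - 1) / Real.sinh y)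
        (κ * Real.sinh y / Real.cosh y)
      = 8 * k ^ 2 / κ ^ 2 * ((Real.sinh y ^ 2)⁻¹ * (1 + (Real.sinh y ^ 2)⁻¹) *
        (12 * ((Real.sinh y ^ 2)⁻¹) ^ 2 + 15 * (Real.sinh y ^ 2)⁻¹ + 4)) := by
  have hs := Real.sinh_ne_zero.2 hy
  have hcs := Real.cosh_sq y
  have hc := (Real.cosh_pos y).ne'
  generalize Real.cosh y = c at *
  generalize Real.sinh y = s at *
  have hprod : k * (c + 1) / s * (k * (c - 1) / s) = k ^ 2 := by
    field_simp
    grind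
  have hdiff : (k * (c + 1) / s - k * (c - 1) / s) ^ 2 = 4 * k ^ 2 / s ^ 2 := by
    field
  have hsum : (k * (c + 1) / s) ^ 2 + (k * (c - 1) / s) ^ 2 = 4 * k ^ 2 / s ^ 2 + 2 * k ^ 2 := by
    field_simp
    grind
  have hlast : (κ * s / c) ^ 2 = κ ^ 2 * s ^ 2 / (s ^ 2 + 1) := by
    rw [← hcs, div_pow, mul_pow]
  have : s ^ 2 + 1 ≠ 0 := by positivity
  rw [cottonDensitySq, hprod, hdiff, hsum, hlast]
  field

theorem strictMonoOn_cottonDensity_polynomial :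
    StrictMonoOn (fun q : ℝ => q * (1 + q) * (12 * q ^ 2 + 15 * q + 4)) (Ici 0) := by
  intro q hq r _ hqr
  have hq₀ : 0 ≤ q := hq
  dsimp only
  gcongr

theorem exists_sinh_cosh_coefficients {A B C : ℝ} (hB : 0 < B) (hC : 0 < C) (hBA : B < A) :
    ∃ k κ y : ℝ, 0 < k ∧ 0 < κ ∧ 0 < y ∧ k * (Real.cosh y + 1) / Real.sinh y = A ∧
      k * (Real.cosh y - 1) / Real.sinh y = B ∧ κ * Real.sinh y / Real.cosh y = C := by
  have hA : 0 < A := hB.trans hBA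
  have hd : 0 < A - B := sub_pos.2 hBA
  have hk : 0 < Real.sqrt (A * B) := Real.sqrt_pos.2 (by positivity)
  have hk2 : Real.sqrt (A * B) ^ 2 = A * B := Real.sq_sqrt (by positivity)
  generalize Real.sqrt (A * B) = k at hk hk2
  have hs := Real.sinh_arsinh (2 * k / (A - B))
  have hc : Real.cosh (Real.arsinh (2 * k / (A - B))) = (A + B) / (A - B) := by
    have hsq : 1 + (2 * k / (A - B)) ^ 2 = ((A + B) / (A - B)) ^ 2 := by
      field_simp
      linear_combination 4 * hk2
    rw [Real.cosh_arsinh, hsq, Real.sqrt_sq (by positivity)]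
  refine ⟨k, C * (A + B) / (2 * k), Real.arsinh (2 * k / (A - B)), hk, by positivity,
    Real.arsinh_pos_iff.2 (by positivity), ?_, ?_, ?_⟩ <;> rw [hs, hc] <;> field

theorem exists_isCoefficientFlow_of_lt {A B C : ℝ} (hB : 0 < B) (hC : 0 < C) (hBA : B < A) :
    ∃ a b c : ℝ → ℝ, IsCoefficientFlow a b c ∧ a 0 = A ∧ b 0 = B ∧ c 0 = C ∧
      StrictAntiOn (fun t => cottonDensitySq (a t) (b t) (c t)) (Ici 0) ∧
      Tendsto (fun t => cottonDensitySq (a t) (b t) (c t)) atTop (𝓝 0) := by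
  obtain ⟨k, κ, y, hk, hκ, hy, ha, hb, hc⟩ := exists_sinh_cosh_coefficients hB hC hBA
  have hdensity := fun t (ht : t ∈ Ici (0 : ℝ)) =>
    (cottonDensitySq_of_sinh hk.ne' hκ.ne' (flowParam_pos hκ hy ht).ne').symm
  refine ⟨_, _, _, isCoefficientFlow_flowParam hk hκ hy, by rw [flowParam_zero, ha],
    by rw [flowParam_zero, hb], by rw [flowParam_zero, hc], ?_, ?_⟩
  · refine StrictAntiOn.congr (fun s hs t ht hst => ?_) hdensity
    exact mul_lt_mul_of_pos_left (strictMonoOn_cottonDensity_polynomial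
      (mem_Ici.2 (by positivity)) (mem_Ici.2 (by positivity))
      (strictAntiOn_inv_sinh_sq_flowParam hκ hy hs ht hst)) (by positivity)
  · have hcont : Continuous fun q : ℝ =>
        8 * k ^ 2 / κ ^ 2 * (q * (1 + q) * (12 * q ^ 2 + 15 * q + 4)) := by fun_prop
    have hlim := (hcont.tendsto 0).comp (tendsto_inv_sinh_sq_flowParam hκ hy)
    simp only [zero_mul, mul_zero] at hlim
    exact hlim.congr' ((eventually_ge_atTop 0).mono hdensity)

theorem exists_isCoefficientFlow {A B C : ℝ} (hA : 0 < A) (hB : 0 < B) (hC : 0 < C) :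
    ∃ a b c : ℝ → ℝ, IsCoefficientFlow a b c ∧ a 0 = A ∧ b 0 = B ∧ c 0 = C ∧
      (A ≠ B → StrictAntiOn (fun t => cottonDensitySq (a t) (b t) (c t)) (Ici 0) ∧
        Tendsto (fun t => cottonDensitySq (a t) (b t) (c t)) atTop (𝓝 0)) ∧
      (A = B → ∀ t, cottonDensitySq (a t) (b t) (c t) = 0) := by
  rcases lt_trichotomy A B with h | rfl | h
  · obtain ⟨b, a, c, hflow, hb, ha, hc, hdecay⟩ := exists_isCoefficientFlow_of_lt hA hC h
    refine ⟨a, b, c, hflow.swap, ha, hb, hc, fun _ => ?_, fun hAB => (h.ne hAB).elim⟩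
    simpa only [cottonDensitySq_comm] using hdecay
  · exact ⟨_, _, _, isCoefficientFlow_const hA hC, rfl, rfl, rfl, fun h => (h rfl).elim,
      fun _ _ => cottonDensitySq_self _ _⟩
  · obtain ⟨a, b, c, hflow, ha, hb, hc, hdecay⟩ := exists_isCoefficientFlow_of_lt hB hC h
    exact ⟨a, b, c, hflow, ha, hb, hc, fun _ => hdecay, fun hAB => (h.ne' hAB).elim⟩

/-! ### Left-invariant metrics and Milnor frames -/

theorem mul_eq_add_mulVec (a p : Pt) : mul a p = a + rot (a 2) *ᵥ p := by
  funext i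
  fin_cases i <;> simp [mul, rot, dotProduct, Fin.sum_univ_three]
  ring

theorem mul_zero_right (a : Pt) : mul a 0 = a := by
  rw [mul_eq_add_mulVec, Matrix.mulVec_zero, add_zero]

theorem rot_mul_apply_two (a p : Pt) (φ : ℝ) :
    rot (mul a p 2 + φ) = rot (a 2) * rot (p 2 + φ) := by
  rw [← rot_add, ← add_assoc]
  rfl

theorem fderiv_mul (a p u : Pt) : fderiv ℝ (mul a) p u = rot (a 2) *ᵥ u := by
  have hmul : mul a = fun p => a + (Matrix.mulVecLin (rot (a 2))).toContinuousLinearMap p :=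
    funext (mul_eq_add_mulVec a)
  rw [hmul, fderiv_const_add, ContinuousLinearMap.fderiv]
  rfl

theorem app_eq_dotProduct (T : Form) (p u v : Pt) : T.app p u v = u ⬝ᵥ T p *ᵥ v := by
  simp only [Form.app, Matrix.mulVec, dotProduct, Fin.sum_univ_three]
  ring

theorem mulVec_rot_injective (ψ : ℝ) : Function.Injective (rot ψ).mulVec :=
  Matrix.mulVec_injective_iff_isUnit.2 (IsUnit.of_mul_eq_one_right _ (rot_transpose_mul ψ))

theorem leftInvariantForm_app (φ : ℝ) (M : Matrix (Fin 3) (Fin 3) ℝ) (p u v : Pt) :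
    (leftInvariantForm φ M).app p (rot (p 2 + φ) *ᵥ u) (rot (p 2 + φ) *ᵥ v) = u ⬝ᵥ M *ᵥ v := by
  rw [app_eq_dotProduct, leftInvariantForm, act₂_eq_mul, Matrix.mulVec_mulVec, Matrix.mul_assoc,
    rot_transpose_mul, Matrix.mul_one, ← Matrix.mulVec_mulVec, Matrix.dotProduct_mulVec,
    Matrix.vecMul_mulVec, rot_transpose_mul, Matrix.vecMul_one]

theorem isLeftInvariant_leftInvariantForm (φ : ℝ) (M : Matrix (Fin 3) (Fin 3) ℝ) :
    IsLeftInvariant (leftInvariantForm φ M) := by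
  have hsurj : ∀ p : Pt, Function.Surjective (rot (p 2 + φ)).mulVec := fun p =>
    Matrix.mulVec_surjective_iff_isUnit.2 (IsUnit.of_mul_eq_one_right _ (rot_transpose_mul _))
  intro a p u v
  obtain ⟨u, rfl⟩ := hsurj p u
  obtain ⟨v, rfl⟩ := hsurj p v
  simp only [fderiv_mul, Matrix.mulVec_mulVec, ← rot_mul_apply_two, leftInvariantForm_app]

theorem IsLeftInvariant.eq_leftInvariantForm {g : Form} (hg : IsLeftInvariant g) :
    g = leftInvariantForm 0 (g 0) := by
  funext p
  have hzero : (rot (p 2))ᵀ * g p * rot (p 2) = g 0 := by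
    ext i j
    have hentry : ∀ N : Matrix (Fin 3) (Fin 3) ℝ,
        N i j = Pi.single i 1 ⬝ᵥ N *ᵥ Pi.single j 1 := fun N => by simp
    have happ := hg p 0 (Pi.single i 1) (Pi.single j 1)
    rw [fderiv_mul, fderiv_mul, mul_zero_right, app_eq_dotProduct, app_eq_dotProduct] at happ
    rw [hentry (_ * _), hentry (g 0), ← happ, ← Matrix.mulVec_mulVec, ← Matrix.mulVec_mulVec,
      Matrix.dotProduct_mulVec, Matrix.vecMul_transpose]
  have hQ : rot (p 2) * (rot (p 2))ᵀ = 1 := mul_eq_one_comm.1 (rot_transpose_mul _)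
  rw [leftInvariantForm, add_zero, act₂_eq_mul, ← hzero, Matrix.mul_assoc, Matrix.mul_assoc,
    Matrix.mul_assoc, hQ, Matrix.mul_one, ← Matrix.mul_assoc, hQ, Matrix.one_mul]

theorem posDef_act₂_rot {M : Matrix (Fin 3) (Fin 3) ℝ} (hM : M.PosDef) (ψ : ℝ) :
    (act₂ (rot ψ) M).PosDef := by
  have hunit : IsUnit (rot ψ) := IsUnit.of_mul_eq_one_right _ (rot_transpose_mul ψ)
  rw [act₂_eq_mul, ← Matrix.conjTranspose_eq_transpose_of_trivial]
  exact (Matrix.IsUnit.posDef_star_right_conjugate_iff hunit).2 hM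

theorem contDiff_rot {n : ℕ∞} (i a : Fin 3) : ContDiff ℝ n fun s => rot s i a := by
  fin_cases i <;> fin_cases a <;>
    simp [rot, contDiff_const, Real.contDiff_cos, Real.contDiff_sin, Real.contDiff_sin.neg]

theorem isRiemannianMetric_leftInvariantForm (φ : ℝ) {M : Matrix (Fin 3) (Fin 3) ℝ}
    (hM : M.PosDef) : IsRiemannianMetric (leftInvariantForm φ M) where
  smooth i j := by
    have hrot : ∀ i a, ContDiff ℝ ∞ fun p : Pt => rot (p 2 + φ) i a := fun i a =>
      (contDiff_rot i a).comp (by fun_prop)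
    simp only [leftInvariantForm, act₂_apply]
    fun_prop
  posDef _ := posDef_act₂_rot hM _

theorem diagForm_eq_conj (v w A B C : ℝ) : diagForm v w A B C
    = !![1, 0, -v; 0, 1, -w; 0, 0, 1]ᴴ * Matrix.diagonal ![A, B, C]
      * !![1, 0, -v; 0, 1, -w; 0, 0, 1] := by
  ext i j
  fin_cases i <;> fin_cases j <;>
    simp [diagForm, Matrix.mul_apply, Fin.sum_univ_three, Matrix.diagonal] <;> ring

theorem posDef_diagForm (v w : ℝ) {A B C : ℝ} (hA : 0 < A) (hB : 0 < B) (hC : 0 < C) :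
    (diagForm v w A B C).PosDef := by
  have hunit : IsUnit (!![1, 0, -v; 0, 1, -w; 0, 0, 1] : Matrix (Fin 3) (Fin 3) ℝ) := by
    rw [Matrix.isUnit_iff_isUnit_det]
    simp [Matrix.det_fin_three]
  rw [diagForm_eq_conj]
  refine (Matrix.IsUnit.posDef_star_left_conjugate_iff hunit).2 (Matrix.PosDef.diagonal ?_)
  intro i
  fin_cases i <;> assumption

theorem exists_rotation_angle (m d : ℝ) :
    ∃ φ : ℝ, m * (Real.cos φ ^ 2 - Real.sin φ ^ 2) = d * (Real.sin φ * Real.cos φ) := by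
  let z : ℂ := ⟨d, 2 * m⟩
  have hre : ‖z‖ * Real.cos z.arg = d := Complex.norm_mul_cos_arg z
  have him : ‖z‖ * Real.sin z.arg = 2 * m := Complex.norm_mul_sin_arg z
  have hcos : Real.cos z.arg = Real.cos (z.arg / 2) ^ 2 - Real.sin (z.arg / 2) ^ 2 := by
    rw [← Real.cos_two_mul', mul_div_cancel₀ _ two_ne_zero]
  have hsin : Real.sin z.arg = 2 * Real.sin (z.arg / 2) * Real.cos (z.arg / 2) := by
    rw [← Real.sin_two_mul, mul_div_cancel₀ _ two_ne_zero]
  refine ⟨z.arg / 2, ?_⟩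
  rw [← hcos]
  linear_combination (1 / 2) * Real.sin z.arg * hre - (1 / 2) * Real.cos z.arg * him
    + (d / 2) * hsin

theorem eq_diagForm {N : Matrix (Fin 3) (Fin 3) ℝ} (hN : N.PosDef) (h01 : N 0 1 = 0) :
    N = diagForm (-(N 0 2 / N 0 0)) (-(N 1 2 / N 1 1)) (N 0 0) (N 1 1)
      (N 2 2 - N 0 2 ^ 2 / N 0 0 - N 1 2 ^ 2 / N 1 1) := by
  have hsymm : ∀ i j, N i j = N j i := fun i j => by simpa using hN.isHermitian.apply j i
  have h0 := (hN.diag_pos (i := 0)).ne'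
  have h1 := (hN.diag_pos (i := 1)).ne'
  ext i j
  fin_cases i <;> fin_cases j <;> simp [diagForm, h01, hsymm 1 0, hsymm 2 0, hsymm 2 1] <;> field

theorem exists_eq_act₂_rot_diagForm {M : Matrix (Fin 3) (Fin 3) ℝ} (hM : M.PosDef) :
    ∃ φ v w A B C : ℝ, 0 < A ∧ 0 < B ∧ 0 < C ∧ M = act₂ (rot φ) (diagForm v w A B C) := by
  obtain ⟨φ, hφ⟩ := exists_rotation_angle (M 0 1) (M 0 0 - M 1 1)
  have hsymm : M 1 0 = M 0 1 := by simpa using hM.isHermitian.apply 0 1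
  have h01 : act₂ (rot (-φ)) M 0 1 = 0 := by
    simp only [act₂_apply, rot, Fin.sum_univ_three, hsymm, Real.cos_neg, Real.sin_neg,
      Matrix.of_apply, Matrix.cons_val]
    linear_combination hφ
  have hMN : M = act₂ (rot φ) (act₂ (rot (-φ)) M) := by
    rw [act₂_mul_act₂, ← rot_add, add_neg_cancel, rot_zero, act₂_one_left]
  have hN := posDef_act₂_rot hM (-φ)
  generalize act₂ (rot (-φ)) M = N at hN hMN h01
  have hdiag := eq_diagForm hN h01
  have hA := hN.diag_pos (i := 0)
  have hB := hN.diag_pos (i := 1)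
  refine ⟨φ, _, _, _, _, _, hA, hB, ?_, hdiag ▸ hMN⟩
  have hdet := hN.det_pos
  rw [hdiag, det_diagForm] at hdet
  exact pos_of_mul_pos_right hdet (by positivity)

theorem exists_eq_leftInvariantForm_diagForm {g : Form} (hg : IsRiemannianMetric g)
    (hinv : IsLeftInvariant g) :
    ∃ φ v w A B C : ℝ, 0 < A ∧ 0 < B ∧ 0 < C ∧ g = leftInvariantForm φ (diagForm v w A B C) := by
  obtain ⟨φ, v, w, A, B, C, hA, hB, hC, hzero⟩ := exists_eq_act₂_rot_diagForm (hg.posDef 0)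
  refine ⟨φ, v, w, A, B, C, hA, hB, hC, ?_⟩
  rw [hinv.eq_leftInvariantForm, hzero, leftInvariantForm_act₂, zero_add]

/-- The left-invariant vector field on the group whose value where the angle is `-φ` is `f`. -/
def leftInvariantField (φ : ℝ) (f : Pt) : Pt → Pt := fun p => rot (p 2 + φ) *ᵥ f

theorem isLeftInvariantField_leftInvariantField (φ : ℝ) (f : Pt) :
    IsLeftInvariantField (leftInvariantField φ f) := fun a p => by
  simp only [leftInvariantField, fderiv_mul, Matrix.mulVec_mulVec, rot_mul_apply_two]

theorem IsLeftInvariantField.eq_leftInvariantField {X : Pt → Pt} (hX : IsLeftInvariantField X)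
    (φ : ℝ) : X = leftInvariantField φ (rot (-φ) *ᵥ X 0) := by
  funext p
  have hzero := hX p 0
  rw [fderiv_mul, mul_zero_right] at hzero
  rw [leftInvariantField, Matrix.mulVec_mulVec, ← rot_add, add_neg_cancel_right, hzero]

theorem leftInvariantField_smul (φ c : ℝ) (f p : Pt) :
    leftInvariantField φ (c • f) p = c • leftInvariantField φ f p :=
  Matrix.mulVec_smul _ c f

/-- The Lie bracket of the Lie algebra of left-invariant vector fields. -/
def frameBracket (f h : Pt) : Pt := f 2 • rotGen *ᵥ h - h 2 • rotGen *ᵥ f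

theorem fderiv_leftInvariantField (φ : ℝ) (f p u : Pt) :
    fderiv ℝ (leftInvariantField φ f) p u = u 2 • leftInvariantField φ (rotGen *ᵥ f) p := by
  have hangle : HasFDerivAt (fun q : Pt => q 2 + φ)
      (ContinuousLinearMap.proj (R := ℝ) (φ := fun _ : Fin 3 => ℝ) 2) p :=
    (hasFDerivAt_apply (𝕜 := ℝ) (2 : Fin 3) p).add_const φ
  have hrot : HasDerivAt (fun s => rot s *ᵥ f) (leftInvariantField φ (rotGen *ᵥ f) p)
      (p 2 + φ) := by
    rw [leftInvariantField, Matrix.mulVec_mulVec]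
    refine hasDerivAt_pi.2 fun i => ?_
    simp only [Matrix.mulVec, dotProduct]
    exact HasDerivAt.fun_sum fun a _ => (hasDerivAt_rot _ i a).mul_const (f a)
  have hcomp := hrot.hasFDerivAt.comp p hangle
  change HasFDerivAt (leftInvariantField φ f) _ p at hcomp
  rw [hcomp.fderiv]
  rfl

theorem lieBracket_leftInvariantField (φ : ℝ) (f h p : Pt) :
    VectorField.lieBracket ℝ (leftInvariantField φ f) (leftInvariantField φ h) p
      = leftInvariantField φ (frameBracket f h) p := by
  have htwo : ∀ f : Pt, leftInvariantField φ f p 2 = f 2 := fun f => by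
    simp [leftInvariantField, rot, Matrix.mulVec, dotProduct, Fin.sum_univ_three]
  simp only [VectorField.lieBracket_eq, fderiv_leftInvariantField, htwo]
  simp only [leftInvariantField, frameBracket, Matrix.mulVec_sub, Matrix.mulVec_smul]

/-- A basis of the Lie algebra that is orthogonal for `diagForm v w A B C` and satisfies the Milnor
bracket relations. -/
def milnorBasis (v w : ℝ) : Fin 3 → Pt := ![![1, 0, 0], ![0, 1, 0], ![-2 * v, -2 * w, -2]]

theorem linearIndependent_milnorBasis (v w : ℝ) : LinearIndependent ℝ (milnorBasis v w) := by
  have hrow : LinearIndependent ℝ (Matrix.of (milnorBasis v w)).row := by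
    rw [Matrix.linearIndependent_rows_iff_isUnit, Matrix.isUnit_iff_isUnit_det]
    simp [milnorBasis, Matrix.det_fin_three]
  exact hrow

theorem frameBracket_milnorBasis (v w : ℝ) :
    frameBracket (milnorBasis v w 1) (milnorBasis v w 2) = (-2 : ℝ) • milnorBasis v w 0 ∧
    frameBracket (milnorBasis v w 2) (milnorBasis v w 0) = (-2 : ℝ) • milnorBasis v w 1 ∧
    frameBracket (milnorBasis v w 0) (milnorBasis v w 1) = 0 := by
  refine ⟨?_, ?_, ?_⟩ <;> funext i <;> fin_cases i <;>
    simp [frameBracket, milnorBasis, rotGen]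

-- The third coefficient is `4 C` because the third basis vector has angular component `-2`.
theorem isMilnorFrame_milnorBasis (φ v w : ℝ) {A B C : ℝ} (hA : 0 < A) (hB : 0 < B) (hC : 0 < C) :
    IsMilnorFrame (leftInvariantForm φ (diagForm v w A B C))
      (fun i => leftInvariantField φ (milnorBasis v w i)) A B (4 * C) where
  leftInvariant i := isLeftInvariantField_leftInvariantField φ _
  bracket_23 p := by
    rw [lieBracket_leftInvariantField, (frameBracket_milnorBasis v w).1, leftInvariantField_smul]
  bracket_31 p := by
    rw [lieBracket_leftInvariantField, (frameBracket_milnorBasis v w).2.1, leftInvariantField_smul]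
  bracket_12 p := by
    rw [lieBracket_leftInvariantField, (frameBracket_milnorBasis v w).2.2, leftInvariantField,
      Matrix.mulVec_zero]
  linearIndependent p := (linearIndependent_milnorBasis v w).map'
    (Matrix.mulVecLin (rot (p 2 + φ))) (LinearMap.ker_eq_bot.2 (mulVec_rot_injective _))
  pos := ⟨hA, hB, by positivity⟩
  diagonal p i j := by
    rw [leftInvariantField, leftInvariantField, leftInvariantForm_app]
    fin_cases i <;> fin_cases j <;>
      simp [milnorBasis, diagForm, Matrix.mulVec, dotProduct, Fin.sum_univ_three] <;> ring

theorem frameBracket_eq (f h : Pt) :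
    frameBracket f h = ![h 2 * f 1 - f 2 * h 1, f 2 * h 0 - h 2 * f 0, 0] := by
  funext i
  fin_cases i <;> simp [frameBracket, rotGen, dotProduct, Fin.sum_univ_three]
  ring

theorem eq_of_frameBracket {f₁ f₂ f₃ : Pt} (h23 : frameBracket f₂ f₃ = (-2 : ℝ) • f₁)
    (h31 : frameBracket f₃ f₁ = (-2 : ℝ) • f₂) (hne : f₁ ≠ 0) :
    ∃ x y ε : ℝ, ε ^ 2 = 1 ∧ x ^ 2 + y ^ 2 ≠ 0 ∧ f₁ = ![x, y, 0] ∧ f₂ = ![ε * y, -(ε * x), 0] := by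
  have hf₁ : f₁ 2 = 0 := by simpa [frameBracket_eq] using congrFun h23 2
  have hf₂ : f₂ 2 = 0 := by simpa [frameBracket_eq] using congrFun h31 2
  have h23x : f₃ 2 * f₂ 1 = -(2 * f₁ 0) := by simpa [frameBracket_eq, hf₂] using congrFun h23 0
  have h23y : f₃ 2 * f₂ 0 = 2 * f₁ 1 := by simpa [frameBracket_eq, hf₂] using congrFun h23 1
  have h31x : f₃ 2 * f₁ 1 = 2 * f₂ 0 := by simpa [frameBracket_eq, hf₁] using congrFun h31 0
  have h31y : f₃ 2 * f₁ 0 = -(2 * f₂ 1) := by simpa [frameBracket_eq, hf₁] using congrFun h31 1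
  have hsq : f₁ 0 ^ 2 + f₁ 1 ^ 2 ≠ 0 := by
    contrapose! hne
    have h0 : f₁ 0 = 0 := by nlinarith [sq_nonneg (f₁ 1)]
    have h1 : f₁ 1 = 0 := by nlinarith [sq_nonneg (f₁ 0)]
    funext i
    fin_cases i
    exacts [h0, h1, hf₁]
  refine ⟨f₁ 0, f₁ 1, f₃ 2 / 2, ?_, hsq, ?_, ?_⟩
  · refine mul_right_cancel₀ hsq ?_
    linear_combination (f₃ 2 * f₁ 0 / 4) * h31y + (f₃ 2 * f₁ 1 / 4) * h31x
      - (f₁ 0 / 2) * h23x + (f₁ 1 / 2) * h23y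
  · funext i
    fin_cases i
    exacts [rfl, rfl, hf₁]
  · funext i
    fin_cases i
    · change f₂ 0 = f₃ 2 / 2 * f₁ 1
      linarith
    · change f₂ 1 = -(f₃ 2 / 2 * f₁ 0)
      linarith
    · exact hf₂

theorem dotProduct_diagForm_mulVec (v w A B C x y x' y' : ℝ) :
    ![x, y, 0] ⬝ᵥ diagForm v w A B C *ᵥ ![x', y', 0] = A * (x * x') + B * (y * y') := by
  simp [diagForm, Matrix.mulVec, dotProduct, Fin.sum_univ_three]
  ring

theorem eq_iff_of_diagonalized {A B A₀ B₀ x y : ℝ} (hxy : x ^ 2 + y ^ 2 ≠ 0)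
    (hA₀ : A₀ = A * x ^ 2 + B * y ^ 2) (hB₀ : B₀ = A * y ^ 2 + B * x ^ 2)
    (hcross : (A - B) * (x * y) = 0) : A₀ = B₀ ↔ A = B := by
  constructor
  · intro heq
    have hdiff : (A - B) * (x ^ 2 - y ^ 2) = 0 := by linear_combination heq - hA₀ + hB₀
    have hzero : (A - B) * (x ^ 2 + y ^ 2) ^ 2 = 0 := by
      linear_combination (x ^ 2 - y ^ 2) * hdiff + 4 * (x * y) * hcross
    exact sub_eq_zero.1 ((mul_eq_zero.1 hzero).resolve_right (pow_ne_zero 2 hxy))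
  · rintro rfl
    rw [hA₀, hB₀, add_comm]

theorem IsMilnorFrame.coeff_eq_iff {φ v w A B C : ℝ} {F : Fin 3 → Pt → Pt} {A₀ B₀ C₀ : ℝ}
    (hF : IsMilnorFrame (leftInvariantForm φ (diagForm v w A B C)) F A₀ B₀ C₀) :
    A₀ = B₀ ↔ A = B := by
  obtain ⟨f, rfl⟩ : ∃ f : Fin 3 → Pt, F = fun i => leftInvariantField φ (f i) :=
    ⟨_, funext fun i => (hF.leftInvariant i).eq_leftInvariantField φ⟩
  have hinj : Function.Injective fun u => leftInvariantField φ u 0 := mulVec_rot_injective _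
  have h23 := hF.bracket_23 0
  have h31 := hF.bracket_31 0
  have hne := (hF.linearIndependent 0).ne_zero 0
  rw [lieBracket_leftInvariantField, ← leftInvariantField_smul] at h23 h31
  have hne' : f 0 ≠ 0 := fun h => hne (by rw [h, leftInvariantField, Matrix.mulVec_zero])
  obtain ⟨x, y, ε, hε, hxy, h₀, h₁⟩ := eq_of_frameBracket (hinj h23) (hinj h31) hne'
  have hdiag : ∀ i j, f i ⬝ᵥ diagForm v w A B C *ᵥ f j = Matrix.diagonal ![A₀, B₀, C₀] i j :=
    fun i j => by simpa only [leftInvariantField, leftInvariantForm_app] using hF.diagonal 0 i j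
  have h00 := hdiag 0 0
  have h11 := hdiag 1 1
  have h01 := hdiag 0 1
  rw [h₀, dotProduct_diagForm_mulVec, Matrix.diagonal_apply_eq, Matrix.cons_val_zero] at h00
  rw [h₁, dotProduct_diagForm_mulVec, Matrix.diagonal_apply_eq, Matrix.cons_val_one,
    Matrix.cons_val_zero] at h11
  rw [h₀, h₁, dotProduct_diagForm_mulVec, Matrix.diagonal_apply_ne _ zero_ne_one] at h01
  refine eq_iff_of_diagonalized hxy ?_ ?_ ?_
  · linear_combination -h00
  · linear_combination -h11 + (A * y ^ 2 + B * x ^ 2) * hε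
  · linear_combination ε * h01 - (A - B) * (x * y) * hε

/-! ### Uniqueness of the left-invariant flow -/

theorem eqOn_Ico_of_hasDerivWithinAt {E : Type*} [NormedAddCommGroup E] [NormedSpace ℝ E]
    {V : E → E} {x y : ℝ → E} {a b : ℝ}
    (hx : ∀ t ∈ Ico a b, HasDerivWithinAt x (V (x t)) (Ico a b) t)
    (hy : ∀ t ∈ Ico a b, HasDerivWithinAt y (V (y t)) (Ico a b) t)
    (hVx : ∀ t ∈ Ico a b, ContDiffAt ℝ 1 V (x t)) (hVy : ∀ t ∈ Ico a b, ContDiffAt ℝ 1 V (y t))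
    (ha : x a = y a) : EqOn x y (Ico a b) := by
  intro t ht
  have hsub : Icc a t ⊆ Ico a b := Icc_subset_Ico_right ht.2
  have hnhds : ∀ s ∈ Ico a t, Ico a b ∈ 𝓝[≥] s := fun s hs =>
    mem_of_superset (Ico_mem_nhdsGE (hs.2.trans ht.2)) (Ico_subset_Ico_left hs.1)
  have hxcont : ContinuousOn x (Icc a t) := fun s hs =>
    (hx s (hsub hs)).continuousWithinAt.mono hsub
  have hycont : ContinuousOn y (Icc a t) := fun s hs =>
    (hy s (hsub hs)).continuousWithinAt.mono hsub
  have hlocal : LocallyLipschitzOn (x '' Icc a t ∪ y '' Icc a t) V := by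
    intro z hz
    have hz : ContDiffAt ℝ 1 V z := by
      rcases hz with ⟨s, hs, rfl⟩ | ⟨s, hs, rfl⟩
      exacts [hVx s (hsub hs), hVy s (hsub hs)]
    obtain ⟨K, U, hU, hK⟩ := hz.exists_lipschitzOnWith
    exact ⟨K, U, mem_nhdsWithin_of_mem_nhds hU, hK⟩
  obtain ⟨K, hK⟩ := hlocal.exists_lipschitzOnWith_of_compact
    ((isCompact_Icc.image_of_continuousOn hxcont).union
      (isCompact_Icc.image_of_continuousOn hycont))
  exact ODE_solution_unique_of_mem_Icc_right (v := fun _ => V) (s := fun _ => _)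
    (fun _ _ => hK)
    hxcont (fun s hs => (hx s (hsub ⟨hs.1, hs.2.le⟩)).mono_of_mem_nhdsWithin (hnhds s hs))
    (fun s hs => Or.inl (mem_image_of_mem x ⟨hs.1, hs.2.le⟩))
    hycont (fun s hs => (hy s (hsub ⟨hs.1, hs.2.le⟩)).mono_of_mem_nhdsWithin (hnhds s hs))
    (fun s hs => Or.inr (mem_image_of_mem y ⟨hs.1, hs.2.le⟩))
    ha ⟨ht.1, le_rfl⟩

section ContDiffAt

variable {N : Fin 3 → Fin 3 → ℝ}

theorem contDiffAt_matrix_inv (hN : (Matrix.of N).det ≠ 0) (k l : Fin 3) :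
    ContDiffAt ℝ 1 (fun N : Fin 3 → Fin 3 → ℝ => (Matrix.of N)⁻¹ k l) N := by
  have hdet : ContDiff ℝ 1 fun N : Fin 3 → Fin 3 → ℝ => (Matrix.of N).det := by
    simp only [Matrix.det_fin_three, Matrix.of_apply]
    fun_prop
  have hadj : ContDiff ℝ 1 fun N : Fin 3 → Fin 3 → ℝ => (Matrix.of N).adjugate k l := by
    simp only [Matrix.adjugate_apply, Matrix.det_fin_three, Matrix.updateRow_apply,
      Matrix.of_apply]
    split_ifs <;> fun_prop
  simp only [Matrix.inv_def, Ring.inverse_eq_inv', Matrix.smul_apply, smul_eq_mul]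
  exact (hdet.contDiffAt.inv hN).mul hadj.contDiffAt

theorem contDiff_frameGrad (l i j : Fin 3) :
    ContDiff ℝ 1 fun N : Fin 3 → Fin 3 → ℝ => frameGrad (Matrix.of N) l i j := by
  simp only [frameGrad, angDeriv₂, Matrix.add_apply, Matrix.mul_apply, Matrix.of_apply]
  split_ifs <;> fun_prop

theorem contDiffAt_frameChristoffel (hN : (Matrix.of N).det ≠ 0) (k i j : Fin 3) :
    ContDiffAt ℝ 1 (fun N : Fin 3 → Fin 3 → ℝ => frameChristoffel (Matrix.of N) k i j) N := by
  unfold frameChristoffel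
  exact contDiffAt_const.mul (ContDiffAt.sum fun l _ => (contDiffAt_matrix_inv hN k l).mul
    (((contDiff_frameGrad i j l).add (contDiff_frameGrad j i l)).sub
      (contDiff_frameGrad l i j)).contDiffAt)

theorem contDiffAt_frameRicci (hN : (Matrix.of N).det ≠ 0) :
    ContDiffAt ℝ 1
      (fun (N : Fin 3 → Fin 3 → ℝ) (i j : Fin 3) => -2 * frameRicci (Matrix.of N) i j) N := by
  have hΓ := contDiffAt_frameChristoffel hN
  refine contDiffAt_pi.2 fun i => contDiffAt_pi.2 fun j => ?_
  simp only [frameRicci, angDeriv₃, angDeriv₂, Matrix.add_apply, Matrix.mul_apply,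
    Matrix.of_apply]
  split_ifs <;> fun_prop

end ContDiffAt

theorem IsRicciFlowOn.mono {I J : Set ℝ} {g : ℝ → Form} (hg : IsRicciFlowOn J g) (h : I ⊆ J) :
    IsRicciFlowOn I g where
  metric t ht := hg.metric t (h ht)
  evolution t ht p i j := (hg.evolution t (h ht) p i j).mono h

theorem IsLeftInvariant.ricci_zero {g : Form} (hg : IsLeftInvariant g) :
    ricci g 0 = frameRicci (g 0) := by
  rw [hg.eq_leftInvariantForm, ricci_leftInvariantForm]
  simp only [leftInvariantForm, Pi.zero_apply, zero_add, rot_zero, act₂_one_left]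

theorem IsRicciFlowOn.hasDerivWithinAt_zero {I : Set ℝ} {g : ℝ → Form} (hg : IsRicciFlowOn I g)
    (hinv : ∀ t ∈ I, IsLeftInvariant (g t)) {t : ℝ} (ht : t ∈ I) :
    HasDerivWithinAt (fun s i j => g s 0 i j) (fun i j => -2 * frameRicci (g t 0) i j) I t :=
  hasDerivWithinAt_pi.2 fun i => hasDerivWithinAt_pi.2 fun j =>
    (hinv t ht).ricci_zero ▸ hg.evolution t ht 0 i j

theorem IsRicciFlowOn.eqOn {T : ℝ} {g g' : ℝ → Form} (hg : IsRicciFlowOn (Ico 0 T) g)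
    (hg' : IsRicciFlowOn (Ico 0 T) g') (hinv : ∀ t ∈ Ico 0 T, IsLeftInvariant (g t))
    (hinv' : ∀ t ∈ Ico 0 T, IsLeftInvariant (g' t)) (h0 : g 0 = g' 0) : EqOn g g' (Ico 0 T) := by
  intro t ht
  have hsmooth : ∀ {g : ℝ → Form}, IsRicciFlowOn (Ico 0 T) g → ∀ s ∈ Ico 0 T, _ := fun hg s hs =>
    contDiffAt_frameRicci (((hg.metric s hs).posDef 0).det_pos.ne')
  have hzero : g t 0 = g' t 0 :=
    eqOn_Ico_of_hasDerivWithinAt (fun s hs => hg.hasDerivWithinAt_zero hinv hs)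
      (fun s hs => hg'.hasDerivWithinAt_zero hinv' hs) (hsmooth hg) (hsmooth hg')
      (by rw [h0]) ht
  rw [(hinv t ht).eq_leftInvariantForm, (hinv' t ht).eq_leftInvariantForm, hzero]

/-! ### Existence of the flow and decay of the Cotton-York tensor -/

theorem diagForm_eq_smul_add (v w A B C : ℝ) : diagForm v w A B C
    = A • diagForm v w 1 0 0 + B • diagForm v w 0 1 0 + C • diagForm v w 0 0 1 := by
  ext i j
  fin_cases i <;> fin_cases j <;> simp [diagForm]

theorem diagForm_mul (v w r A B C : ℝ) :
    diagForm v w (r * A) (r * B) (r * C) = r • diagForm v w A B C := by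
  ext i j
  fin_cases i <;> fin_cases j <;> simp [diagForm, mul_assoc]
  ring

theorem hasDerivAt_act₂_diagForm (Q : Matrix (Fin 3) (Fin 3) ℝ) (v w : ℝ) {a b c : ℝ → ℝ}
    {a' b' c' t : ℝ} (ha : HasDerivAt a a' t) (hb : HasDerivAt b b' t) (hc : HasDerivAt c c' t)
    (i j : Fin 3) :
    HasDerivAt (fun s => act₂ Q (diagForm v w (a s) (b s) (c s)) i j)
      (act₂ Q (diagForm v w a' b' c') i j) t := by
  simp only [diagForm_eq_smul_add v w (a _), diagForm_eq_smul_add v w a', map_add, map_smul,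
    Matrix.add_apply, Matrix.smul_apply, smul_eq_mul]
  exact ((ha.mul_const _).add (hb.mul_const _)).add (hc.mul_const _)

namespace IsCoefficientFlow

variable {a b c : ℝ → ℝ}

theorem isRicciFlowOn (h : IsCoefficientFlow a b c) (φ v w : ℝ) :
    IsRicciFlowOn (Ici 0) fun t => leftInvariantForm φ (diagForm v w (a t) (b t) (c t)) where
  metric t ht :=
    have ⟨ha, hb, hc⟩ := h.pos t ht
    isRiemannianMetric_leftInvariantForm φ (posDef_diagForm v w ha hb hc)
  evolution t ht p i j := by
    obtain ⟨ha, hb, hc⟩ := h.pos t ht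
    have hderiv := hasDerivAt_act₂_diagForm (rot (p 2 + φ)) v w (h.deriv_a t ht) (h.deriv_b t ht)
      (h.deriv_c t ht) i j
    rw [diagForm_mul, map_smul] at hderiv
    rw [ricci_leftInvariantForm, frameRicci_diagForm v w ha.ne' hb.ne' hc.ne']
    exact hderiv.hasDerivWithinAt

theorem cottonYorkL1_eq (h : IsCoefficientFlow a b c) (K : Set Pt) (φ v w : ℝ) {t : ℝ}
    (ht : 0 ≤ t) :
    cottonYorkL1 K (leftInvariantForm φ (diagForm v w (a t) (b t) (c t)))
      = volume.real K * √(cottonDensitySq (a t) (b t) (c t)) :=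
  cottonYorkL1_diagForm K φ v w (h.pos t ht).1 (h.pos t ht).2.1 (h.pos t ht).2.2

theorem strictAntiOn_cottonYorkL1 (h : IsCoefficientFlow a b c)
    (hanti : StrictAntiOn (fun t => cottonDensitySq (a t) (b t) (c t)) (Ici 0)) {K : Set Pt}
    (hK : 0 < volume.real K) (φ v w : ℝ) :
    StrictAntiOn
      (fun t => cottonYorkL1 K (leftInvariantForm φ (diagForm v w (a t) (b t) (c t)))) (Ici 0) :=
  StrictAntiOn.congr
    (fun _ hs _ ht hst => mul_lt_mul_of_pos_left
      (Real.sqrt_lt_sqrt (cottonDensitySq_nonneg _ _ _) (hanti hs ht hst)) hK)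
    fun _ ht => (h.cottonYorkL1_eq K φ v w ht).symm

theorem tendsto_cottonYorkL1 (h : IsCoefficientFlow a b c)
    (hlim : Tendsto (fun t => cottonDensitySq (a t) (b t) (c t)) atTop (𝓝 0)) (K : Set Pt)
    (φ v w : ℝ) :
    Tendsto (fun t => cottonYorkL1 K (leftInvariantForm φ (diagForm v w (a t) (b t) (c t))))
      atTop (𝓝 0) := by
  have hmul := hlim.sqrt.const_mul (volume.real K)
  rw [Real.sqrt_zero, mul_zero] at hmul
  exact hmul.congr' ((eventually_ge_atTop 0).mono fun t ht =>
    (h.cottonYorkL1_eq K φ v w ht).symm)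

end IsCoefficientFlow

end CottonFlow

end

theorem theorem3p4 (g₀ : CottonFlow.Form)
    (hg₀ : CottonFlow.IsRiemannianMetric g₀) (hinv : CottonFlow.IsLeftInvariant g₀) :
    -- a Milnor frame for the initial metric exists
    (∃ (F : Fin 3 → CottonFlow.Pt → CottonFlow.Pt) (A₀ B₀ C₀ : ℝ),
      CottonFlow.IsMilnorFrame g₀ F A₀ B₀ C₀) ∧
    -- the left-invariant Ricci flow from `g₀` exists for all time and is unique
    ∃ g : ℝ → CottonFlow.Form,
      g 0 = g₀ ∧ CottonFlow.IsRicciFlowOn (Set.Ici 0) g ∧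
      (∀ t, 0 ≤ t → CottonFlow.IsLeftInvariant (g t)) ∧
      (∀ (T : ℝ) (g' : ℝ → CottonFlow.Form), 0 < T → g' 0 = g₀ →
        CottonFlow.IsRicciFlowOn (Set.Ico 0 T) g' →
        (∀ t ∈ Set.Ico 0 T, CottonFlow.IsLeftInvariant (g' t)) →
        ∀ t ∈ Set.Ico 0 T, g' t = g t) ∧
      -- the behaviour of the `L¹`-norm of the Cotton-York tensor
      ∀ (F : Fin 3 → CottonFlow.Pt → CottonFlow.Pt) (A₀ B₀ C₀ : ℝ),
        CottonFlow.IsMilnorFrame g₀ F A₀ B₀ C₀ →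
        ∀ K : Set CottonFlow.Pt, IsCompact K →
          (A₀ ≠ B₀ →
            (0 < MeasureTheory.volume K →
              StrictAntiOn (fun t => CottonFlow.cottonYorkL1 K (g t)) (Set.Ici 0)) ∧
            Filter.Tendsto (fun t => CottonFlow.cottonYorkL1 K (g t)) Filter.atTop (nhds 0)) ∧
          (A₀ = B₀ → ∀ t, 0 ≤ t → CottonFlow.cottonYorkL1 K (g t) = 0) := by
  obtain ⟨φ, v, w, A, B, C, hA, hB, hC, rfl⟩ :=
    CottonFlow.exists_eq_leftInvariantForm_diagForm hg₀ hinv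
  obtain ⟨a, b, c, hflow, rfl, rfl, rfl, hne, heq⟩ :=
    CottonFlow.exists_isCoefficientFlow hA hB hC
  have hricci := hflow.isRicciFlowOn φ v w
  have hleft := fun t => CottonFlow.isLeftInvariant_leftInvariantForm φ
    (CottonFlow.diagForm v w (a t) (b t) (c t))
  refine ⟨⟨_, _, _, _, CottonFlow.isMilnorFrame_milnorBasis φ v w hA hB hC⟩,
    _, rfl, hricci, fun t _ => hleft t, fun T g' _ h0 hg' hinv' => ?_,
    fun F A₀ B₀ C₀ hF K hK => ⟨fun hAB => ?_, fun hAB t ht => ?_⟩⟩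
  · exact hg'.eqOn (hricci.mono Set.Ico_subset_Ici_self) hinv' (fun t _ => hleft t) h0
  · obtain ⟨hanti, hlim⟩ := hne (mt hF.coeff_eq_iff.2 hAB)
    refine ⟨fun hpos => ?_, hflow.tendsto_cottonYorkL1 hlim K φ v w⟩
    have hvol : 0 < MeasureTheory.volume.real K :=
      ENNReal.toReal_pos hpos.ne' hK.measure_lt_top.ne
    exact hflow.strictAntiOn_cottonYorkL1 hanti hvol φ v w
  · rw [hflow.cottonYorkL1_eq K φ v w ht, heq (hF.coeff_eq_iff.1 hAB), Real.sqrt_zero, mul_zero]
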